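/- For a finite group $G$ and a subset $S \subseteq G$, the bi-Cayley graph $\mathrm{BCay}(G,S)$ is the graph with vertex set $G \times \{0,1\}$ and edge set $\{\{(x,0),(sx,1)\} : x \in G,\ s \in S\}$. It is called a BCI-graph if for every $T \subseteq G$, $\mathrm{BCay}(G,S) \cong \mathrm{BCay}(G,T)$ implies that $T = gS^{\alpha}$ for some $g \in G$ and $\alpha \in \mathrm{Aut}(G)$. A group is homocyclic if it is a direct product of cyclic groups of the same order, and a graph is arc-transitive if its automorphism group acts transitively on its arcs (ordered pairs of adjacent vertices). Theorem. Let $G$ be a finite group of the form $G \cong U \times V$, where $U$ is a homocyclic group of odd order, and $V$ is trivial or one of the groups $\mathbb{Z}_{2^r}$, $\mathbb{Z}_2^r$ and $Q_8$ (with $r$ a natural number and $Q_8$ the quaternion group of order $8$). Let $S \subseteq G$ with $|S| = 3$, and suppose that $\mathrm{BCay}(G,S)$ is not arc-transitive. Then $\mathrm{BCay}(G,S)$ is a BCI-graph. -/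

import Mathlib

/-- The bi-Cayley graph `BCay(G, S)`: vertex set `G × {0, 1}`, edge set
`{ {(x, 0), (s * x, 1)} : x ∈ G, s ∈ S }`. -/
def bcay {G : Type*} [Group G] (S : Set G) : SimpleGraph (G × Fin 2) where
  Adj v w := ∃ x : G, ∃ s ∈ S,
    (v = (x, 0) ∧ w = (s * x, 1)) ∨ (v = (s * x, 1) ∧ w = (x, 0))
  symm := by
    constructor
    rintro v w ⟨x, s, hs, h | h⟩
    · exact ⟨x, s, hs, Or.inr ⟨h.2, h.1⟩⟩
    · exact ⟨x, s, hs, Or.inl ⟨h.2, h.1⟩⟩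
  loopless := by
    constructor
    rintro v ⟨x, s, hs, ⟨h, h'⟩ | ⟨h, h'⟩⟩ <;>
      · rw [h] at h'
        simp at h'

/-- `BCay(G, S)` is a BCI-graph: whenever `BCay(G, S) ≅ BCay(G, T)` as graphs, one has
`T = g S^α` for some `g ∈ G` and `α ∈ Aut(G)`. -/
def IsBCIGraph {G : Type*} [Group G] (S : Set G) : Prop :=
  ∀ T : Set G, Nonempty (bcay S ≃g bcay T) →
    ∃ (g : G) (α : G ≃* G), T = (fun s => g * α s) '' S

/-- A graph is arc-transitive if its automorphism group is transitive on its arcs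
(ordered pairs of adjacent vertices). -/
def IsArcTransitive {V : Type*} (Γ : SimpleGraph V) : Prop :=
  ∀ v w v' w' : V, Γ.Adj v w → Γ.Adj v' w' → ∃ φ : Γ ≃g Γ, φ v = v' ∧ φ w = w'

/-- A finite group is homocyclic if it is a direct product of (finitely many) cyclic groups
of the same order. -/
def IsHomocyclic (U : Type*) [Group U] : Prop :=
  Finite U ∧ ∃ n k : ℕ, Nonempty (U ≃* (Fin k → Multiplicative (ZMod n)))

/-- The class of all groups `U × V` (up to isomorphism), where `U` is homocyclic of odd order and
`V` is trivial or one of the groups `Z_{2^r}`, `Z_2^r`, `Q_8`. -/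
def IsInClassC (G : Type*) [Group G] : Prop :=
  ∃ (U V : Type) (_ : Group U) (_ : Group V),
    (IsHomocyclic U ∧ Odd (Nat.card U)) ∧
    (Subsingleton V ∨
      (∃ r : ℕ, Nonempty (V ≃* Multiplicative (ZMod (2 ^ r)))) ∨
      (∃ r : ℕ, Nonempty (V ≃* (Fin r → Multiplicative (ZMod 2)))) ∨
      Nonempty (V ≃* QuaternionGroup 2)) ∧
    Nonempty (G ≃* U × V)

/-! An automorphism of `G` inverts any two given elements (inversion on abelian factors, conjugation
in `Q₈`), so the graph has an automorphism exchanging its two sides. Without arc-transitivity, the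
stabiliser of `(1, 0)` is then intransitive on the three neighbours, so it fixes one of them, `(s₀,
1)`. Isomorphisms preserve the perfect matching `(x, 0) — (s₀ x, 1)`. Contracting it turns an
isomorphism onto `BCay(G, T)` into a map `φ` between Cayley digraphs of valency two, with connection
sets `{a, b} = {s₀⁻¹ s₁, s₀⁻¹ s₂}` and `{c, d} = {t₀⁻¹ t₁, t₀⁻¹ t₂}` (`localIso_of_bcay_iso`). An
automorphism of `G` carrying one pair to the other solves the problem; that it exists is
`LocallyRigid`.

At every vertex `φ` sends the labels `a, b` to `c, d` in one of two orders. If the order never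
changes, both pairs satisfy the same relations, and `PairHomogeneous` supplies the automorphism. For
commuting pairs the order is constant unless the two generators have equal squares. In that
exceptional case they differ by an involution, and orders of elements (for a unique involution) or
the two coordinates separately (for exponent two) decide. For `Q₈`, non-commuting pairs are handled
through the centrality of squares, and mixed cases are impossible. -/

/-! ### Pair homogeneity of homocyclic groups and of coprime products -/

/-- A pair of elements can be moved to any other pair satisfying the same relations. -/
def PairHomogeneous (G : Type*) [Group G] : Prop :=
  ∀ a b c d : G,
    (∀ w : FreeGroup (Fin 2), FreeGroup.lift ![a, b] w = 1 ↔ FreeGroup.lift ![c, d] w = 1) →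
      ∃ α : G ≃* G, α a = c ∧ α b = d

/-- In a pair `f, f'` of homomorphisms with the same kernel, adjoining `g` to `f` and `y` to `f'`
with compatible `p`-th powers preserves relations in one direction. -/
theorem mul_zpow_eq_one_of_ker {A G : Type*} [Group A] [CommGroup G] {f f' : A →* G}
    (h : ∀ w, f w = 1 ↔ f' w = 1) {p : ℕ} (hp : p.Prime) {g y : G} (hg : g ∉ f.range)
    {w₀ : A} (hgp : g ^ p = f w₀) (hyp : y ^ p = f' w₀) {w : A} {j : ℤ}
    (hw : f w * g ^ j = 1) : f' w * y ^ j = 1 := by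
  have hj : (p : ℤ) ∣ j := by
    by_contra hj
    have hc : IsCoprime (p : ℤ) j := by
      rw [Int.isCoprime_iff_gcd_eq_one]
      rcases (Nat.coprime_or_dvd_of_prime hp j.natAbs) with h1 | h1
      · simpa [Int.gcd] using h1
      · exact absurd (Int.natCast_dvd.2 h1) hj
    obtain ⟨u, v, huv⟩ := hc
    apply hg
    have h1 : g ^ j ∈ f.range := by
      rw [eq_inv_of_mul_eq_one_right hw]
      exact inv_mem ⟨w, rfl⟩
    have h2 : g ^ (p : ℤ) ∈ f.range := ⟨w₀, by simp [hgp]⟩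
    have h3 : g = (g ^ (p : ℤ)) ^ u * (g ^ j) ^ v := by
      rw [← zpow_mul, ← zpow_mul, ← zpow_add, mul_comm _ u, mul_comm _ v, huv, zpow_one]
    rw [h3]
    exact mul_mem (zpow_mem h2 u) (zpow_mem h1 v)
  obtain ⟨i, rfl⟩ := hj
  have e1 : f (w * w₀ ^ i) = 1 := by
    rw [map_mul, map_zpow, ← hgp, ← zpow_natCast, ← zpow_mul, hw]
  have e2 := (h _).1 e1
  rwa [map_mul, map_zpow, ← hyp, ← zpow_natCast, ← zpow_mul] at e2

theorem mulEquiv_of_ker_eq_of_surjective {A G : Type*} [Group A] [Group G] [Finite G]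
    {f f' : A →* G} (h : ∀ w, f w = 1 ↔ f' w = 1) (hf : Function.Surjective f) :
    ∃ α : G ≃* G, ∀ w, α (f w) = f' w := by
  have inj : ∀ w w', f w = f w' ↔ f' w = f' w' := fun w w' => by
    rw [← mul_inv_eq_one, ← map_inv, ← map_mul, h, map_mul, map_inv, mul_inv_eq_one]
  choose s hs using hf
  have key : ∀ w, f' (s (f w)) = f' w := fun w => (inj _ _).1 (hs _)
  let F : G →* G := MonoidHom.mk' (fun x => f' (s x)) fun x y => by
    rw [← map_mul, ← inj, hs, map_mul, hs, hs]
  have hF : Function.Injective F := fun x y hxy => by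
    have := (inj (s x) (s y)).2 hxy
    rwa [hs, hs] at this
  exact ⟨MulEquiv.ofBijective F (Finite.injective_iff_bijective.1 hF), key⟩

/-- A finite abelian group in which `p`-divisibility is detected by annihilation: homomorphisms
into it with the same kernel differ by an automorphism. -/
theorem exists_mulEquiv_of_ker_eq {G : Type*} [CommGroup G] [Finite G]
    (hdiv : ∀ p : ℕ, p.Prime → ∃ N : ℕ, ∀ x : G, (∃ y, y ^ p = x) ↔ x ^ N = 1)
    (R : Subgroup G) : ∀ (A : Type) [Group A] (f f' : A →* G), f.range = R →
      (∀ w, f w = 1 ↔ f' w = 1) → ∃ α : G ≃* G, ∀ w, α (f w) = f' w := by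
  induction R using WellFoundedGT.induction with
  | _ R ih =>
  intro A _ f f' hR h
  by_cases hsurj : Function.Surjective f
  · exact mulEquiv_of_ker_eq_of_surjective h hsurj
  have inj : ∀ w w', f w = f w' ↔ f' w = f' w' := fun w w' => by
    rw [← mul_inv_eq_one, ← map_inv, ← map_mul, h, map_mul, map_inv, mul_inv_eq_one]
  obtain ⟨p, hp, g, hg, w₀, hgp⟩ :
      ∃ p : ℕ, p.Prime ∧ ∃ g, g ∉ f.range ∧ ∃ w₀, g ^ p = f w₀ := by
    have hcard : Nat.card (G ⧸ f.range) ≠ 1 := by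
      intro h1
      exact hsurj (MonoidHom.range_eq_top.1 (Subgroup.index_eq_one.1 h1))
    obtain ⟨p, hp, hpd⟩ := Nat.exists_prime_and_dvd hcard
    have : Fact p.Prime := ⟨hp⟩
    obtain ⟨q, hq⟩ := exists_prime_orderOf_dvd_card' p hpd
    obtain ⟨g, rfl⟩ := QuotientGroup.mk_surjective q
    refine ⟨p, hp, g, ?_, ?_⟩
    · intro hg
      rw [(QuotientGroup.eq_one_iff g).2 hg, orderOf_one] at hq
      exact hp.one_lt.ne hq
    · have : ((g ^ p : G) : G ⧸ f.range) = 1 := by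
        rw [QuotientGroup.mk_pow, ← hq, pow_orderOf_eq_one]
      obtain ⟨w, hw⟩ := (QuotientGroup.eq_one_iff _).1 this
      exact ⟨w, hw.symm⟩
  -- Being a `p`-th power is the same as being killed by `N`, which equality of kernels transfers to
  -- `f' w₀`. A root inside `f'.range` is corrected by an element of order `p` outside it.
  obtain ⟨y, hy, hyp⟩ : ∃ y, y ∉ f'.range ∧ y ^ p = f' w₀ := by
    obtain ⟨N, hN⟩ := hdiv p hp
    have h1 : f w₀ ^ N = 1 := (hN _).1 ⟨g, hgp⟩
    rw [← map_pow, h, map_pow] at h1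
    obtain ⟨y₀, hy₀⟩ := (hN _).2 h1
    by_cases hr : y₀ ∈ f'.range
    swap
    · exact ⟨y₀, hr, hy₀⟩
    obtain ⟨w₁, rfl⟩ := hr
    have h2 : f w₁ ^ p = g ^ p := by
      rw [hgp, ← map_pow, inj, map_pow, hy₀]
    obtain ⟨y₁, hy₁, hy₁r⟩ : ∃ y₁ : G, y₁ ^ p = 1 ∧ y₁ ∉ f'.range := by
      by_contra! hcon
      -- If `f'.range` contained all `p`-torsion, lifting along `f'` and applying `f` would permute
      -- the finite set `P`, putting all `p`-torsion into `f.range`. But `g * (f w₁)⁻¹` is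
      -- `p`-torsion outside it.
      let P := {x : G // x ^ p = 1}
      have hc : ∀ x : P, ∃ w, f' w = x := fun x => hcon x x.2
      choose s hs using hc
      have hsp : ∀ x, f (s x) ^ p = 1 := fun x => by
        rw [← map_pow, h, map_pow, hs, x.2]
      let m : P → P := fun x => ⟨f (s x), hsp x⟩
      have hm : Function.Injective m := by
        intro x x' hxx
        have h3 : f (s x) = f (s x') := congrArg Subtype.val hxx
        rw [inj, hs, hs] at h3
        exact Subtype.ext h3
      obtain ⟨x, hx⟩ := (Finite.injective_iff_surjective.1 hm)
        ⟨g * (f w₁)⁻¹, by rw [mul_pow, inv_pow, h2, mul_inv_cancel]⟩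
      have h4 : f (s x) = g * (f w₁)⁻¹ := congrArg Subtype.val hx
      exact hg ⟨s x * w₁, by rw [map_mul, h4, inv_mul_cancel_right]⟩
    refine ⟨f' w₁ * y₁, fun hr => hy₁r ?_, by rw [mul_pow, hy₀, hy₁, mul_one]⟩
    exact (Subgroup.mul_mem_cancel_left _ (MonoidHom.mem_range.2 ⟨w₁, rfl⟩)).1 hr
  -- The extra factor `ℤ` adjoins `g` and `y`; the range grows strictly, so the induction hypothesis
  -- applies.
  let F : A × Multiplicative ℤ →* G := f.coprod (zpowersHom G g)
  let F' : A × Multiplicative ℤ →* G := f'.coprod (zpowersHom G y)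
  have hlt : R < F.range := by
    rw [← hR]
    refine lt_of_le_of_ne ?_ ?_
    · rintro _ ⟨w, rfl⟩
      exact ⟨(w, 1), by simp [F]⟩
    · intro heq
      apply hg
      rw [heq]
      exact ⟨(1, Multiplicative.ofAdd 1), by simp [F]⟩
  obtain ⟨α, hα⟩ := ih _ hlt _ F F' rfl (by
    rintro ⟨w, j⟩
    have e1 : F (w, j) = f w * g ^ j.toAdd := by simp [F]
    have e2 : F' (w, j) = f' w * y ^ j.toAdd := by simp [F']
    rw [e1, e2]
    exact ⟨mul_zpow_eq_one_of_ker h hp hg hgp hyp,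
      mul_zpow_eq_one_of_ker (fun w => (h w).symm) hp hy hyp hgp⟩)
  refine ⟨α, fun w => ?_⟩
  have := hα (w, 1)
  simpa [F, F'] using this

theorem pairHomogeneous_of_div {G : Type*} [CommGroup G] [Finite G]
    (hdiv : ∀ p : ℕ, p.Prime → ∃ N : ℕ, ∀ x : G, (∃ y, y ^ p = x) ↔ x ^ N = 1) :
    PairHomogeneous G := by
  intro a b c d h
  obtain ⟨α, hα⟩ := exists_mulEquiv_of_ker_eq hdiv _ _ _ _ rfl h
  exact ⟨α, by simpa using hα (FreeGroup.of 0), by simpa using hα (FreeGroup.of 1)⟩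

/-- If `n = p * m`, the `p`-th powers are exactly the elements killed by `m`, because all factors
have the same order. If `p ∤ n`, every element is a `p`-th power and `N = 0` serves. -/
theorem pairHomogeneous_pi_zmod (n k : ℕ) [NeZero n] :
    PairHomogeneous (Fin k → Multiplicative (ZMod n)) := by
  apply pairHomogeneous_of_div
  intro p hp
  have tr : ∀ (x : Fin k → Multiplicative (ZMod n)) (m : ℕ),
      x ^ m = 1 ↔ ∀ i, (m : ZMod n) * (x i).toAdd = 0 := by
    intro x m
    rw [funext_iff]
    refine forall_congr' fun i => ?_
    rw [Pi.pow_apply, Pi.one_apply, ← toAdd_eq_zero, toAdd_pow, nsmul_eq_mul]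
  by_cases hpn : p ∣ n
  · obtain ⟨m, hm⟩ := hpn
    refine ⟨m, fun x => ⟨?_, fun hx => ?_⟩⟩
    · rintro ⟨y, rfl⟩
      rw [← pow_mul, tr, ← hm]
      simp
    · have hx' := (tr x m).1 hx
      refine ⟨fun i => Multiplicative.ofAdd (((x i).toAdd.val / p : ℕ) : ZMod n), ?_⟩
      funext i
      have h1 := hx' i
      have hm0 : 0 < m := by
        rcases Nat.eq_zero_or_pos m with h0 | h0
        · exact absurd hm (by simp [h0, NeZero.ne n])
        · exact h0
      have h2 : p ∣ (x i).toAdd.val := by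
        have h3 : ((m * (x i).toAdd.val : ℕ) : ZMod n) = 0 := by
          push_cast
          rw [ZMod.natCast_zmod_val]
          exact h1
        rw [ZMod.natCast_eq_zero_iff] at h3
        refine Nat.dvd_of_mul_dvd_mul_left hm0 (dvd_trans (dvd_of_eq ?_) h3)
        rw [hm, mul_comm]
      apply Multiplicative.toAdd.injective
      rw [Pi.pow_apply, toAdd_pow, toAdd_ofAdd, nsmul_eq_mul, ← Nat.cast_mul,
        Nat.mul_div_cancel' h2, ZMod.natCast_zmod_val]
  · refine ⟨0, fun x => ⟨fun _ => pow_zero x, fun _ => ?_⟩⟩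
    have hc : Nat.Coprime p n := (Nat.Prime.coprime_iff_not_dvd hp).2 hpn
    refine ⟨fun i => Multiplicative.ofAdd ((p : ZMod n)⁻¹ * (x i).toAdd), ?_⟩
    funext i
    apply Multiplicative.toAdd.injective
    rw [Pi.pow_apply, toAdd_pow, toAdd_ofAdd, nsmul_eq_mul, ← mul_assoc,
      ZMod.coe_mul_inv_eq_one p hc, one_mul]

theorem lift_pair_prod {U V : Type*} [Group U] [Group V] (a b : U × V) (w : FreeGroup (Fin 2)) :
    FreeGroup.lift ![a, b] w = (FreeGroup.lift ![a.1, b.1] w, FreeGroup.lift ![a.2, b.2] w) := by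
  have : FreeGroup.lift ![a, b] =
      (FreeGroup.lift ![a.1, b.1]).prod (FreeGroup.lift ![a.2, b.2]) := by
    ext i <;> fin_cases i <;> simp
  rw [this]
  rfl

theorem pow_eq_one_iff_of_card_coprime {G : Type*} [Group G] [Finite G] {n : ℕ}
    (h : (Nat.card G).Coprime n) {x : G} : x ^ n = 1 ↔ x = 1 := by
  refine ⟨fun hx => ?_, fun hx => by rw [hx, one_pow]⟩
  have h1 : orderOf x ∣ Nat.gcd (Nat.card G) n :=
    Nat.dvd_gcd (orderOf_dvd_natCard x) (orderOf_dvd_of_pow_eq_one hx)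
  rw [h] at h1
  exact orderOf_eq_one_iff.1 (Nat.dvd_one.1 h1)

theorem PairHomogeneous.prod {U V : Type*} [Group U] [Group V] [Finite U] [Finite V]
    (hU : PairHomogeneous U) (hV : PairHomogeneous V)
    (hc : (Nat.card U).Coprime (Nat.card V)) : PairHomogeneous (U × V) := by
  intro a b c d h
  have key : ∀ w : FreeGroup (Fin 2),
      (FreeGroup.lift ![a.1, b.1] w = 1 ∧ FreeGroup.lift ![a.2, b.2] w = 1) ↔
      (FreeGroup.lift ![c.1, d.1] w = 1 ∧ FreeGroup.lift ![c.2, d.2] w = 1) := by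
    intro w
    have := h w
    rwa [lift_pair_prod, lift_pair_prod, Prod.mk_eq_one, Prod.mk_eq_one] at this
  obtain ⟨α, hα⟩ := hU a.1 b.1 c.1 d.1 fun w => by
    -- Raising to the power `|V|` kills the second coordinate and, by coprimality, loses nothing in
    -- the first.
    have := key (w ^ Nat.card V)
    simpa only [map_pow, pow_card_eq_one', and_true, pow_eq_one_iff_of_card_coprime hc] using this
  obtain ⟨β, hβ⟩ := hV a.2 b.2 c.2 d.2 fun w => by
    have := key (w ^ Nat.card U)
    simpa only [map_pow, pow_card_eq_one', true_and, pow_eq_one_iff_of_card_coprime hc.symm] using this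
  exact ⟨α.prodCongr β, Prod.ext hα.1 hβ.1, Prod.ext hα.2 hβ.2⟩

/-! ### Pair homogeneity of `Q₈` -/

/-- The endomorphism of `Q₈` determined by the images of the two standard generators. -/
def quaternionMap (x y : QuaternionGroup 2) : QuaternionGroup 2 → QuaternionGroup 2
  | .a i => x ^ i.val
  | .xa i => y * x ^ i.val

/-- Non-commuting elements of `Q₈` satisfy the defining relations of the standard generators. -/
theorem quaternionMap_mul : ∀ x y : QuaternionGroup 2, x * y ≠ y * x → ∀ g h,
    quaternionMap x y (g * h) = quaternionMap x y g * quaternionMap x y h := by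
  decide +kernel

theorem quaternionMap_eq_one : ∀ x y : QuaternionGroup 2, x * y ≠ y * x → ∀ g,
    quaternionMap x y g = 1 → g = 1 := by
  decide +kernel

theorem exists_quaternion_mulEquiv {x y : QuaternionGroup 2} (h : x * y ≠ y * x) :
    ∃ α : QuaternionGroup 2 ≃* QuaternionGroup 2, ∀ g, α g = quaternionMap x y g := by
  let F := MonoidHom.mk' (quaternionMap x y) (quaternionMap_mul x y h)
  have hF : Function.Injective F :=
    (injective_iff_map_eq_one F).2 (quaternionMap_eq_one x y h)
  exact ⟨MulEquiv.ofBijective F (Finite.injective_iff_bijective.1 hF), fun _ => rfl⟩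

/-- Representatives of the orbits of `Aut(Q₈)` on pairs of elements. -/
def quaternionPairs : List (QuaternionGroup 2 × QuaternionGroup 2) :=
  [(.a 0, .a 0), (.a 0, .a 2), (.a 0, .a 1), (.a 2, .a 0), (.a 2, .a 2), (.a 2, .a 1),
    (.a 1, .a 0), (.a 1, .a 2), (.a 1, .a 1), (.a 1, .a 3), (.a 1, .xa 0)]

theorem exists_quaternionPairs : ∀ q r : QuaternionGroup 2, ∃ P ∈ quaternionPairs,
    ∃ x y : QuaternionGroup 2, x * y ≠ y * x ∧
      quaternionMap x y P.1 = q ∧ quaternionMap x y P.2 = r := by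
  decide +kernel

/-- Whether six specific words vanish at a pair of elements. -/
def quaternionInvariant (P : QuaternionGroup 2 × QuaternionGroup 2) : List Bool :=
  [P.1 = 1, P.2 = 1, P.1 ^ 2 = 1, P.2 ^ 2 = 1, P.1 * P.2 = 1, P.1 * P.2⁻¹ = 1]

theorem quaternionPairs_eq : ∀ P ∈ quaternionPairs, ∀ Q ∈ quaternionPairs,
    quaternionInvariant P = quaternionInvariant Q → P = Q := by
  decide +kernel

theorem pairHomogeneous_quaternion : PairHomogeneous (QuaternionGroup 2) := by
  intro a b c d h
  obtain ⟨P, hP, x, y, hxy, hPa, hPb⟩ := exists_quaternionPairs a b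
  obtain ⟨Q, hQ, x', y', hxy', hQc, hQd⟩ := exists_quaternionPairs c d
  obtain ⟨α, hα⟩ := exists_quaternion_mulEquiv hxy
  obtain ⟨β, hβ⟩ := exists_quaternion_mulEquiv hxy'
  rw [← hα] at hPa hPb
  rw [← hβ] at hQc hQd
  have key : ∀ w, FreeGroup.lift ![P.1, P.2] w = 1 ↔ FreeGroup.lift ![Q.1, Q.2] w = 1 := by
    intro w
    have e1 : α (FreeGroup.lift ![P.1, P.2] w) = FreeGroup.lift ![a, b] w := by
      have : α.toMonoidHom.comp (FreeGroup.lift ![P.1, P.2]) = FreeGroup.lift ![a, b] := by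
        ext i; fin_cases i <;> simp [hPa, hPb]
      rw [← this]; rfl
    have e2 : β (FreeGroup.lift ![Q.1, Q.2] w) = FreeGroup.lift ![c, d] w := by
      have : β.toMonoidHom.comp (FreeGroup.lift ![Q.1, Q.2]) = FreeGroup.lift ![c, d] := by
        ext i; fin_cases i <;> simp [hQc, hQd]
      rw [← this]; rfl
    rw [← map_eq_one_iff α α.injective, e1, h, ← e2, map_eq_one_iff β β.injective]
  have hPQ : P = Q := by
    refine quaternionPairs_eq P hP Q hQ ?_
    have h1 := key (FreeGroup.of 0)
    have h2 := key (FreeGroup.of 1)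
    have h3 := key (FreeGroup.of 0 ^ 2)
    have h4 := key (FreeGroup.of 1 ^ 2)
    have h5 := key (FreeGroup.of 0 * FreeGroup.of 1)
    have h6 := key (FreeGroup.of 0 * (FreeGroup.of 1)⁻¹)
    simp only [map_pow, map_mul, map_inv, FreeGroup.lift_apply_of, Matrix.cons_val_zero,
      Matrix.cons_val_one] at h1 h2 h3 h4 h5 h6
    simp only [quaternionInvariant, h1, h2, h3, h4, h5, h6]
  subst hPQ
  refine ⟨α.symm.trans β, ?_, ?_⟩
  · rw [← hPa]; simpa using hQc
  · rw [← hPb]; simpa using hQd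

theorem PairHomogeneous.congr {G G' : Type*} [Group G] [Group G'] (e : G ≃* G')
    (h : PairHomogeneous G) : PairHomogeneous G' := by
  intro a b c d hw
  have key : ∀ x y : G', ∀ w, FreeGroup.lift ![e.symm x, e.symm y] w =
      e.symm (FreeGroup.lift ![x, y] w) := by
    intro x y w
    have : FreeGroup.lift ![e.symm x, e.symm y] =
        e.symm.toMonoidHom.comp (FreeGroup.lift ![x, y]) := by
      ext i; fin_cases i <;> simp
    rw [this]; rfl
  obtain ⟨α, h1, h2⟩ := h (e.symm a) (e.symm b) (e.symm c) (e.symm d) fun w => by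
    rw [key, key, map_eq_one_iff _ e.symm.injective, map_eq_one_iff _ e.symm.injective, hw]
  exact ⟨(e.symm.trans α).trans e, by simp [h1], by simp [h2]⟩

/-! ### Local isomorphisms of Cayley digraphs of valency two -/

/-- At `x`, the map `φ` carries the arcs `x → a * x`, `x → b * x` to the arcs given by `c`, `d`. -/
def ArcStep {G : Type*} [Group G] (φ : G → G) (a b c d x : G) : Prop :=
  φ (a * x) = c * φ x ∧ φ (b * x) = d * φ x

/-- `φ` is an isomorphism, fixing `1`, from the Cayley digraph of `⟨a, b⟩` with connection set
`{a, b}` onto its image in the Cayley digraph with connection set `{c, d}`. -/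
structure LocalIso {G : Type*} [Group G] (φ : G → G) (a b c d : G) : Prop where
  map_one : φ 1 = 1
  injOn : Set.InjOn φ (Subgroup.closure {a, b})
  step : ∀ x ∈ Subgroup.closure {a, b}, ArcStep φ a b c d x ∨ ArcStep φ a b d c x

section closure

variable {G : Type*} [Group G] {a b : G}

theorem left_mem_closure_pair : a ∈ Subgroup.closure {a, b} :=
  Subgroup.subset_closure (Set.mem_insert _ _)

theorem right_mem_closure_pair : b ∈ Subgroup.closure {a, b} :=
  Subgroup.subset_closure (Set.mem_insert_of_mem _ rfl)

theorem left_mul_mem {x : G} (hx : x ∈ Subgroup.closure {a, b}) :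
    a * x ∈ Subgroup.closure {a, b} := mul_mem left_mem_closure_pair hx

theorem right_mul_mem {x : G} (hx : x ∈ Subgroup.closure {a, b}) :
    b * x ∈ Subgroup.closure {a, b} := mul_mem right_mem_closure_pair hx

/-- In a finite group inverses are positive powers, so following arcs forwards reaches the whole
subgroup. -/
theorem closure_pair_induction [Finite G] {p : G → Prop} (one : p 1)
    (left : ∀ x ∈ Subgroup.closure {a, b}, p x → p (a * x))
    (right : ∀ x ∈ Subgroup.closure {a, b}, p x → p (b * x)) {x : G}
    (hx : x ∈ Subgroup.closure {a, b}) : p x := by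
  have hpow : ∀ g ∈ ({a, b} : Set G), ∀ (k : ℕ) (y : G), y ∈ Subgroup.closure {a, b} → p y →
      p (g ^ k * y) := by
    intro g hg k
    induction k with
    | zero => intro y _ hy; simpa using hy
    | succ k ih =>
      intro y hy hpy
      rw [pow_succ, mul_assoc]
      refine ih _ (mul_mem (Subgroup.subset_closure hg) hy) ?_
      rcases hg with rfl | rfl
      · exact left y hy hpy
      · exact right y hy hpy
  refine Subgroup.closure_induction_left (p := fun x _ => p x) one ?_ ?_ hx
  · intro g hg y hy hpy
    simpa using hpow g hg 1 y hy hpy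
  · intro g hg y hy hpy
    have : g⁻¹ = g ^ (orderOf g - 1) := by
      rw [inv_eq_iff_mul_eq_one, ← pow_succ', Nat.sub_add_cancel (orderOf_pos g),
        pow_orderOf_eq_one]
    rw [this]
    exact hpow g hg _ y hy hpy

end closure

/-- An automorphism carries the unordered pair `{a, b}` to `{c, d}`. -/
def PairConj {G : Type*} [Group G] (a b c d : G) : Prop :=
  ∃ α : G ≃* G, (α a = c ∧ α b = d) ∨ (α a = d ∧ α b = c)

theorem PairConj.swap_right {G : Type*} [Group G] {a b c d : G} (h : PairConj a b d c) :
    PairConj a b c d := by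
  obtain ⟨α, h⟩ := h
  exact ⟨α, h.symm⟩

theorem PairConj.swap_left {G : Type*} [Group G] {a b c d : G} (h : PairConj b a c d) :
    PairConj a b c d := by
  obtain ⟨α, h | h⟩ := h
  · exact ⟨α, Or.inr ⟨h.2, h.1⟩⟩
  · exact ⟨α, Or.inl ⟨h.2, h.1⟩⟩

namespace ArcStep

variable {G : Type*} [Group G] {φ : G → G} {a b c d x : G}

theorem symm (h : ArcStep φ a b c d x) : ArcStep φ b a d c x := ⟨h.2, h.1⟩

theorem eq_of_swap (h : ArcStep φ a b c d x) (h' : ArcStep φ a b d c x) : c = d :=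
  mul_right_cancel (h.1.symm.trans h'.1)

end ArcStep

namespace LocalIso

variable {G : Type*} [Group G] {φ : G → G} {a b c d : G}

theorem swap_right (h : LocalIso φ a b c d) : LocalIso φ a b d c :=
  ⟨h.map_one, h.injOn, fun x hx => (h.step x hx).symm⟩

theorem swap_left (h : LocalIso φ a b c d) : LocalIso φ b a c d := by
  refine ⟨h.map_one, ?_, fun x hx => ?_⟩
  · rw [Set.pair_comm]; exact h.injOn
  · rw [Set.pair_comm] at hx
    exact (h.step x hx).symm.imp ArcStep.symm ArcStep.symm

theorem map_mulEquiv {G' : Type*} [Group G'] (e : G ≃* G') (h : LocalIso φ a b c d) :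
    LocalIso (fun x => e (φ (e.symm x))) (e a) (e b) (e c) (e d) := by
  have hmem : ∀ x ∈ Subgroup.closure {e a, e b}, e.symm x ∈ Subgroup.closure {a, b} := by
    intro x hx
    have : Subgroup.closure {e a, e b} ≤ (Subgroup.closure {a, b}).comap e.symm.toMonoidHom := by
      rw [Subgroup.closure_le]
      rintro y (rfl | rfl)
      · simpa using left_mem_closure_pair
      · simpa using right_mem_closure_pair
    exact this hx
  refine ⟨by simp [h.map_one], ?_, fun x hx => ?_⟩
  · intro x hx y hy hxy
    exact e.symm.injective (h.injOn (hmem x hx) (hmem y hy) (e.injective hxy))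
  · rcases h.step _ (hmem x hx) with h1 | h1
    · exact Or.inl ⟨by simp [h1.1], by simp [h1.2]⟩
    · exact Or.inr ⟨by simp [h1.1], by simp [h1.2]⟩

/-- With constant labels, `φ` turns multiplication by a word in `a, b` into multiplication by the
same word in `c, d`; the converse uses injectivity. -/
theorem lift_eq_one_iff (h : LocalIso φ a b c d)
    (hs : ∀ x ∈ Subgroup.closure {a, b}, ArcStep φ a b c d x) (w : FreeGroup (Fin 2)) :
    FreeGroup.lift ![a, b] w = 1 ↔ FreeGroup.lift ![c, d] w = 1 := by
  have hmem : ∀ w, FreeGroup.lift ![a, b] w ∈ Subgroup.closure {a, b} := by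
    intro w
    have : (FreeGroup.lift ![a, b]).range ≤ Subgroup.closure {a, b} := by
      apply FreeGroup.range_lift_le
      rintro _ ⟨i, rfl⟩
      fin_cases i
      · exact left_mem_closure_pair
      · exact right_mem_closure_pair
    exact this ⟨w, rfl⟩
  have hof : ∀ (i : Fin 2), ∀ x ∈ Subgroup.closure {a, b},
      φ (![a, b] i * x) = ![c, d] i * φ x := by
    intro i x hx
    fin_cases i
    · exact (hs x hx).1
    · exact (hs x hx).2
  have key : ∀ w, ∀ x ∈ Subgroup.closure {a, b},
      φ (FreeGroup.lift ![a, b] w * x) = FreeGroup.lift ![c, d] w * φ x := by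
    intro w
    induction w using FreeGroup.induction_on with
    | C1 => simp
    | of i => simpa only [FreeGroup.lift_apply_of] using hof i
    | inv_of i _ =>
      intro x hx
      have hm := hmem (FreeGroup.of i)⁻¹
      rw [map_inv, FreeGroup.lift_apply_of] at hm
      have := hof i _ (mul_mem hm hx)
      rw [mul_inv_cancel_left] at this
      rw [map_inv, map_inv, FreeGroup.lift_apply_of, FreeGroup.lift_apply_of, this,
        inv_mul_cancel_left]
    | mul w w' h1 h2 =>
      intro x hx
      rw [map_mul, map_mul, mul_assoc, h1 _ (mul_mem (hmem w') hx), h2 x hx, mul_assoc]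
  have key1 : φ (FreeGroup.lift ![a, b] w) = FreeGroup.lift ![c, d] w := by
    have := key w 1 (one_mem _)
    rwa [mul_one, h.map_one, mul_one] at this
  refine ⟨fun hw => by rw [← key1, hw, h.map_one], fun hw => ?_⟩
  exact h.injOn (hmem w) (one_mem _) (by rw [key1, hw, h.map_one])

theorem pairConj_of_step (hG : PairHomogeneous G) (h : LocalIso φ a b c d)
    (hs : ∀ x ∈ Subgroup.closure {a, b}, ArcStep φ a b c d x) : PairConj a b c d := by
  obtain ⟨α, hα⟩ := hG _ _ _ _ (h.lift_eq_one_iff hs)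
  exact ⟨α, Or.inl hα⟩

/-- The vertices `aax`, `abx = bax`, `bbx` are distinct. A change of labels at `ax` or `bx` would
send two of them to `cd φ(x) = dc φ(x)`. -/
theorem step_of_comm (h : LocalIso φ a b c d) (hab : a * b = b * a) (hcd : c * d = d * c)
    (hne : a ≠ b) (hsq : a * a ≠ b * b) {x : G} (hx : x ∈ Subgroup.closure {a, b})
    (hs : ArcStep φ a b c d x) : ArcStep φ a b c d (a * x) ∧ ArcStep φ a b c d (b * x) := by
  have hax := left_mul_mem hx
  have hbx := right_mul_mem hx
  have e : a * (b * x) = b * (a * x) := by rw [← mul_assoc, hab, mul_assoc]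
  have n1 : φ (a * (a * x)) ≠ φ (b * (b * x)) := fun he => by
    have := h.injOn (left_mul_mem hax) (right_mul_mem hbx) he
    rw [← mul_assoc, ← mul_assoc] at this
    exact hsq (mul_right_cancel this)
  have n2 : φ (a * (a * x)) ≠ φ (a * (b * x)) := fun he => by
    have := h.injOn (left_mul_mem hax) (left_mul_mem hbx) he
    exact hne (mul_right_cancel (mul_left_cancel this))
  have n3 : φ (b * (b * x)) ≠ φ (b * (a * x)) := fun he => by
    have := h.injOn (right_mul_mem hbx) (right_mul_mem hax) he
    exact hne.symm (mul_right_cancel (mul_left_cancel this))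
  have f : φ (a * (b * x)) = φ (b * (a * x)) := congrArg φ e
  rcases h.step _ hax with h1 | h1 <;> rcases h.step _ hbx with h2 | h2
  · exact ⟨h1, h2⟩
  all_goals
    rw [h1.1, h2.2, hs.1, hs.2] at n1
    rw [h1.1, h2.1, hs.1, hs.2] at n2
    rw [h1.2, h2.2, hs.1, hs.2] at n3
    rw [h1.2, h2.1, hs.1, hs.2] at f
    simp only [← mul_assoc] at n1 n2 n3 f
  · exact absurd (by rw [hcd]) n3
  · exact absurd (by rw [hcd]) n2
  · exact absurd (by rw [hcd]) n1

theorem pairConj_of_comm [Finite G] (hG : PairHomogeneous G) (h : LocalIso φ a b c d)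
    (hab : a * b = b * a) (hcd : c * d = d * c) (hne : a ≠ b) (hsq : a * a ≠ b * b) :
    PairConj a b c d := by
  rcases h.step 1 (one_mem _) with h1 | h1
  · exact h.pairConj_of_step hG fun x hx => closure_pair_induction h1
      (fun x hx hs => (h.step_of_comm hab hcd hne hsq hx hs).1)
      (fun x hx hs => (h.step_of_comm hab hcd hne hsq hx hs).2) hx
  · exact (h.swap_right.pairConj_of_step hG fun x hx => closure_pair_induction h1
      (fun x hx hs => (h.swap_right.step_of_comm hab hcd.symm hne hsq hx hs).1)
      (fun x hx hs => (h.swap_right.step_of_comm hab hcd.symm hne hsq hx hs).2) hx).swap_right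

theorem map_left_mem (h : LocalIso φ a b c d) {x : G} (hx : x ∈ Subgroup.closure {a, b}) :
    φ (a * x) = c * φ x ∨ φ (a * x) = d * φ x :=
  (h.step x hx).imp And.left And.left

/-- Each step multiplies by `c` or `w * c`, and the factors `w` cancel in pairs. -/
theorem map_pow_left (h : LocalIso φ a b c d) {w : G} (hw : w * w = 1) (hwc : w * c = c * w)
    (hd : d = w * c) (k : ℕ) : φ (a ^ k) = c ^ k ∨ φ (a ^ k) = w * c ^ k := by
  induction k with
  | zero => left; simpa using h.map_one
  | succ k ih =>
    have e : c * (w * c ^ k) = w * c ^ (k + 1) := by rw [← mul_assoc, ← hwc, pow_succ', mul_assoc]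
    have e' : w * c * c ^ k = w * c ^ (k + 1) := by rw [pow_succ', mul_assoc]
    have e'' : w * c * (w * c ^ k) = c ^ (k + 1) := by
      rw [mul_assoc, e, ← mul_assoc, hw, one_mul]
    rw [pow_succ']
    rcases h.map_left_mem (pow_mem left_mem_closure_pair k) with h1 | h1 <;>
      rcases ih with h2 | h2 <;> rw [h1, h2]
    · left; rw [pow_succ']
    · right; exact e
    · right; rw [hd]; exact e'
    · left; rw [hd]; exact e''

end LocalIso

/-! ### Generators with equal squares when there is at most one involution -/

section uniqueInvolution

variable {G : Type*} [Group G]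

/-- There is at most one involution. -/
def AtMostOneInvolution (G : Type*) [Group G] : Prop :=
  ∀ x y : G, x * x = 1 → y * y = 1 → x ≠ 1 → y ≠ 1 → x = y

/-- Since `a ^ m` is `1` or `z`, the vertex `a ^ (m + 1)` is an out-neighbour of `1`, so its image
is `c` or `z * c`. By `map_pow_left` the image is also `c ^ (m + 1)` up to `z`, whence `c ^ m` is
`1` or `z`. -/
theorem LocalIso.pow_two_mul_eq_one {φ : G → G} {a c z : G} (hu : AtMostOneInvolution G)
    (h : LocalIso φ a (z * a) c (z * c)) (hz : z * z = 1) (hz1 : z ≠ 1)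
    (hzc : z * c = c * z) {m : ℕ} (hm : a ^ (2 * m) = 1) : c ^ (2 * m) = 1 := by
  have h1 : a ^ (m + 1) = a ∨ a ^ (m + 1) = z * a := by
    by_cases ha : a ^ m = 1
    · left; rw [pow_succ, ha, one_mul]
    · right
      rw [pow_succ, hu (a ^ m) z (by rw [← pow_add, ← two_mul, hm]) hz ha hz1]
  have h2 : φ (a ^ (m + 1)) = c ∨ φ (a ^ (m + 1)) = z * c := by
    have hs := h.step 1 (one_mem _)
    simp only [ArcStep, mul_one, h.map_one] at hs
    rcases h1 with h1 | h1 <;> rcases hs with hs | hs <;> rw [h1]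
    · exact Or.inl hs.1
    · exact Or.inr hs.1
    · exact Or.inr hs.2
    · exact Or.inl hs.2
  have h3 := h.map_pow_left hz hzc rfl (m + 1)
  have h4 : c ^ m = 1 ∨ c ^ m = z := by
    have aux : ∀ y, y * c = c → y = 1 := fun y hy => mul_eq_right.1 hy
    rcases h2 with h2 | h2 <;> rcases h3 with h3 | h3 <;> rw [h2, pow_succ] at h3
    · exact Or.inl (aux _ h3.symm)
    · rw [← mul_assoc] at h3
      refine Or.inr ?_
      rw [eq_inv_of_mul_eq_one_right (aux _ h3.symm), inv_eq_of_mul_eq_one_left hz]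
    · exact Or.inr (mul_right_cancel h3).symm
    · rw [← mul_assoc] at h3
      exact Or.inl (mul_eq_left.1 (mul_right_cancel h3).symm)
  rw [two_mul, pow_add]
  rcases h4 with h4 | h4 <;> rw [h4]
  · exact one_mul 1
  · exact hz

theorem even_orderOf_of_involution [Finite G] {a z : G} (hz : z * z = 1) (hz1 : z ≠ 1)
    (hza : z * a = a * z) (ha : ¬ Even (orderOf a)) : Even (orderOf (z * a)) := by
  by_contra hb
  rw [Nat.not_even_iff_odd] at ha hb
  have h1 : (z * a) ^ (orderOf (z * a) * orderOf a) = 1 := by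
    rw [pow_mul, pow_orderOf_eq_one, one_pow]
  rw [(show Commute z a from hza).mul_pow, mul_comm, pow_mul a, pow_orderOf_eq_one, one_pow,
    mul_one] at h1
  obtain ⟨k, hk⟩ := ha.mul hb
  rw [hk, pow_succ, pow_mul, pow_two, hz, one_pow, one_mul] at h1
  exact hz1 h1

theorem PairHomogeneous.exists_of_orderOf_eq (hG : PairHomogeneous G) {a c : G}
    (h : orderOf a = orderOf c) : ∃ α : G ≃* G, α a = c := by
  have key : ∀ (x : G) (w : FreeGroup (Fin 2)), FreeGroup.lift ![x, x] w =
      x ^ (FreeGroup.lift (fun _ : Fin 2 => Multiplicative.ofAdd (1 : ℤ)) w).toAdd := by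
    intro x w
    have : FreeGroup.lift ![x, x] = (zpowersHom G x).comp
        (FreeGroup.lift (fun _ : Fin 2 => Multiplicative.ofAdd (1 : ℤ))) := by
      ext i; fin_cases i <;> simp
    rw [this]; rfl
  -- On a repeated element a word reduces to its exponent sum, so the order determines all
  -- relations.
  obtain ⟨α, hα, -⟩ := hG a a c c fun w => by
    rw [key, key, ← orderOf_dvd_iff_zpow_eq_one, ← orderOf_dvd_iff_zpow_eq_one, h]
  exact ⟨α, hα⟩

theorem pairConj_of_involution_of_even [Finite G] (hG : PairHomogeneous G)
    (hu : AtMostOneInvolution G) {φ φ' : G → G} {a c z : G}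
    (h : LocalIso φ a (z * a) c (z * c)) (h' : LocalIso φ' c (z * c) a (z * a))
    (hz : z * z = 1) (hz1 : z ≠ 1) (hza : z * a = a * z) (hzc : z * c = c * z)
    (ha : Even (orderOf a)) (hc : Even (orderOf c)) : PairConj a (z * a) c (z * c) := by
  have hord : orderOf a = orderOf c := by
    obtain ⟨m, hm⟩ := ha
    obtain ⟨k, hk⟩ := hc
    apply Nat.dvd_antisymm
    · rw [hk, ← two_mul]
      exact orderOf_dvd_of_pow_eq_one (h'.pow_two_mul_eq_one hu hz hz1 hza
        (by rw [two_mul, ← hk, pow_orderOf_eq_one]))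
    · rw [hm, ← two_mul]
      exact orderOf_dvd_of_pow_eq_one (h.pow_two_mul_eq_one hu hz hz1 hzc
        (by rw [two_mul, ← hm, pow_orderOf_eq_one]))
  obtain ⟨α, hα⟩ := hG.exists_of_orderOf_eq hord
  have hαz : α z = z := hu _ _ (by rw [← map_mul, hz, map_one]) hz
    (by rwa [Ne, map_eq_one_iff _ α.injective]) hz1
  exact ⟨α, Or.inl ⟨hα, by rw [map_mul, hαz, hα]⟩⟩

theorem exists_involution {a b : G} (hab : a * b = b * a) (hne : a ≠ b) (hsq : a * a = b * b) :
    ∃ z : G, z * z = 1 ∧ z ≠ 1 ∧ z * a = a * z ∧ b = z * a := by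
  have hc : Commute a b := hab
  have hci : Commute a⁻¹ b := hc.inv_left
  refine ⟨b * a⁻¹, ?_, fun h => hne (mul_inv_eq_one.1 h).symm, ?_, by rw [inv_mul_cancel_right]⟩
  · rw [mul_assoc, ← mul_assoc a⁻¹, hci.eq, ← mul_assoc, ← mul_assoc, ← hsq, mul_assoc a,
      mul_inv_cancel, mul_one, mul_inv_cancel]
  · rw [inv_mul_cancel_right, ← mul_assoc, hab, mul_inv_cancel_right]

/-- At least one of `a`, `w * a` has even order, and likewise for `c`. Relabelling within the pairs
reduces to even orders, where the orders of `a` and `c` agree and every automorphism fixes the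
involution. -/
theorem pairConj_of_atMostOneInvolution [Finite G] (hG : PairHomogeneous G)
    (hu : AtMostOneInvolution G) {φ φ' : G → G} {a b c d : G}
    (h : LocalIso φ a b c d) (h' : LocalIso φ' c d a b) (hab : a * b = b * a)
    (hcd : c * d = d * c) (hne : a ≠ b) (hne' : c ≠ d) (hsq : a * a = b * b)
    (hsq' : c * c = d * d) : PairConj a b c d := by
  obtain ⟨z, hz, hz1, hza, rfl⟩ := exists_involution hab hne hsq
  obtain ⟨w, hw, hw1, hwc, rfl⟩ := exists_involution hcd hne' hsq'
  obtain rfl := hu w z hw hz hw1 hz1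
  have inv : ∀ x : G, w * (w * x) = x := fun x => by rw [← mul_assoc, hz, one_mul]
  have comm : ∀ x : G, w * x = x * w → w * (w * x) = w * x * w := fun x hx => by
    rw [mul_assoc, ← hx]
  by_cases ha : Even (orderOf a) <;> by_cases hc : Even (orderOf c)
  · exact pairConj_of_involution_of_even hG hu h h' hz hz1 hza hwc ha hc
  · have := pairConj_of_involution_of_even (c := w * c) (φ := φ) (φ' := φ') hG hu
      (by rw [inv]; exact h.swap_right) (by rw [inv]; exact h'.swap_left) hz hz1 hza
      (comm c hwc) ha (even_orderOf_of_involution hz hz1 hwc hc)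
    rw [inv] at this
    exact this.swap_right
  · have := pairConj_of_involution_of_even (a := w * a) (φ := φ) (φ' := φ') hG hu
      (by rw [inv]; exact h.swap_left) (by rw [inv]; exact h'.swap_right) hz hz1
      (comm a hza) hwc (even_orderOf_of_involution hz hz1 hza ha) hc
    rw [inv] at this
    exact this.swap_left
  · have := pairConj_of_involution_of_even (a := w * a) (c := w * c) (φ := φ) (φ' := φ') hG hu
      (by rw [inv, inv]; exact h.swap_left.swap_right)
      (by rw [inv, inv]; exact h'.swap_left.swap_right) hz hz1
      (comm a hza) (comm c hwc) (even_orderOf_of_involution hz hz1 hza ha)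
      (even_orderOf_of_involution hz hz1 hwc hc)
    rw [inv, inv] at this
    exact this.swap_left.swap_right

end uniqueInvolution

/-! ### Local rigidity, and facts on groups of odd order -/

/-- Isomorphic local Cayley digraphs of out-valency two come from automorphisms. -/
def LocallyRigid (G : Type*) [Group G] : Prop :=
  ∀ (φ φ' : G → G) (a b c d : G), a ≠ b → c ≠ d → LocalIso φ a b c d → LocalIso φ' c d a b →
    PairConj a b c d

theorem LocallyRigid.congr {G G' : Type*} [Group G] [Group G'] (e : G ≃* G')
    (h : LocallyRigid G) : LocallyRigid G' := by
  intro φ φ' a b c d hab hcd h1 h2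
  obtain ⟨α, hα⟩ := h _ _ _ _ _ _ (e.symm.injective.ne hab) (e.symm.injective.ne hcd)
    (h1.map_mulEquiv e.symm) (h2.map_mulEquiv e.symm)
  refine ⟨(e.symm.trans α).trans e, hα.imp ?_ ?_⟩ <;>
  · rintro ⟨h3, h4⟩
    simp [h3, h4]

theorem LocallyRigid.of_commGroup {G : Type*} [CommGroup G] [Finite G]
    (hG : PairHomogeneous G)
    (hsq : ∀ (φ φ' : G → G) (a b c d : G), a ≠ b → c ≠ d → LocalIso φ a b c d →
      LocalIso φ' c d a b → a * a = b * b → c * c = d * d → PairConj a b c d) :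
    LocallyRigid G := by
  intro φ φ' a b c d hab hcd h1 h2
  by_cases h : a * a = b * b
  · by_cases h' : c * c = d * d
    · exact hsq φ φ' a b c d hab hcd h1 h2 h h'
    · obtain ⟨α, hα⟩ := h2.pairConj_of_comm hG (mul_comm _ _) (mul_comm _ _) hcd h'
      refine ⟨α.symm, hα.imp ?_ ?_⟩
      · rintro ⟨rfl, rfl⟩; simp
      · rintro ⟨rfl, rfl⟩; simp
  · exact h1.pairConj_of_comm hG (mul_comm _ _) (mul_comm _ _) hab h

theorem locallyRigid_of_atMostOneInvolution {G : Type*} [CommGroup G] [Finite G]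
    (hG : PairHomogeneous G) (hu : AtMostOneInvolution G) : LocallyRigid G :=
  .of_commGroup hG fun _ _ _ _ _ _ hab hcd h1 h2 =>
    pairConj_of_atMostOneInvolution hG hu h1 h2 (mul_comm _ _) (mul_comm _ _) hab hcd

section oddPart

variable {U : Type*} [Group U] [Finite U]

theorem pow_pow_two_eq_one_iff (hU : Odd (Nat.card U)) (k : ℕ) {x : U} :
    x ^ (2 ^ k) = 1 ↔ x = 1 :=
  pow_eq_one_iff_of_card_coprime (Nat.Coprime.pow_right k (Nat.coprime_two_right.2 hU))

theorem eq_of_sq_eq_of_odd {U : Type*} [CommGroup U] [Finite U] (hU : Odd (Nat.card U)) {x y : U}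
    (h : x * x = y * y) : x = y := by
  rw [← mul_inv_eq_one, ← pow_pow_two_eq_one_iff hU 1, pow_one, pow_two, mul_mul_mul_comm, h,
    ← mul_inv, mul_inv_cancel]

theorem atMostOneInvolution_prod {V : Type*} [Group V] (hU : Odd (Nat.card U))
    (hV : AtMostOneInvolution V) : AtMostOneInvolution (U × V) := by
  have h1 : ∀ x : U × V, x * x = 1 → x.1 = 1 := fun x hx =>
    (pow_pow_two_eq_one_iff hU 1).1 (by rw [pow_one, pow_two]; exact congrArg Prod.fst hx)
  intro x y hx hy hx1 hy1
  have hx2 : x.2 ≠ 1 := fun h => hx1 (Prod.ext (h1 x hx) h)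
  have hy2 : y.2 ≠ 1 := fun h => hy1 (Prod.ext (h1 y hy) h)
  exact Prod.ext ((h1 x hx).trans (h1 y hy).symm)
    (hV _ _ (congrArg Prod.snd hx) (congrArg Prod.snd hy) hx2 hy2)

end oddPart

theorem atMostOneInvolution_of_isCyclic {V : Type*} [Group V] [Finite V] [IsCyclic V] :
    AtMostOneInvolution V := by
  classical
  have := Fintype.ofFinite V
  intro x y hx hy hx1 hy1
  by_contra hne
  have hle := IsCyclic.card_pow_eq_one_le (α := V) (n := 2) two_pos
  have hsub : ({1, x, y} : Finset V) ⊆ Finset.univ.filter (fun a : V => a ^ 2 = 1) := by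
    intro t ht
    simp only [Finset.mem_insert, Finset.mem_singleton] at ht
    rcases ht with rfl | rfl | rfl <;> simp [pow_two, *]
  have hc : ({1, x, y} : Finset V).card = 3 := by
    rw [Finset.card_eq_three]
    exact ⟨1, x, y, hx1.symm, hy1.symm, hne, rfl⟩
  have := Finset.card_le_card hsub
  omega

/-! ### Products of an odd abelian group with one of exponent two -/

section exponentTwo

variable {V : Type*} [CommGroup V]

theorem exists_lift_eq_pow (hV : ∀ v : V, v ^ 2 = 1) (p p' q q' : V) (w : FreeGroup (Fin 2)) :
    ∃ i j : ℕ, FreeGroup.lift ![p, p'] w = p ^ i * p' ^ j ∧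
      FreeGroup.lift ![q, q'] w = q ^ i * q' ^ j := by
  have hinv : ∀ v : V, v⁻¹ = v := fun v => inv_eq_of_mul_eq_one_left (by rw [← pow_two, hV])
  induction w using FreeGroup.induction_on with
  | C1 => exact ⟨0, 0, by simp⟩
  | of i =>
    fin_cases i
    · exact ⟨1, 0, by simp⟩
    · exact ⟨0, 1, by simp⟩
  | inv_of i ih =>
    obtain ⟨i, j, h1, h2⟩ := ih
    exact ⟨i, j, by rw [map_inv, hinv, h1], by rw [map_inv, hinv, h2]⟩
  | mul w w' h1 h2 =>
    obtain ⟨i, j, h1, h1'⟩ := h1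
    obtain ⟨k, l, h2, h2'⟩ := h2
    refine ⟨i + k, j + l, ?_, ?_⟩
    · rw [map_mul, h1, h2, pow_add, pow_add, mul_mul_mul_comm]
    · rw [map_mul, h1', h2', pow_add, pow_add, mul_mul_mul_comm]

theorem PairHomogeneous.exists_of_exponent_two (hV : ∀ v : V, v ^ 2 = 1) (hh : PairHomogeneous V)
    {p p' q q' : V} (hp : p ≠ p') (hq : q ≠ q') (h : p = 1 ↔ q = 1) (h' : p' = 1 ↔ q' = 1) :
    ∃ α : V ≃* V, α p = q ∧ α p' = q' := by
  have hinv : ∀ v : V, v⁻¹ = v := fun v => inv_eq_of_mul_eq_one_left (by rw [← pow_two, hV])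
  have hodd : ∀ (v : V) (k : ℕ), v ^ (2 * k + 1) = v := fun v k => by
    rw [pow_succ, pow_mul, hV, one_pow, one_mul]
  have heven : ∀ (v : V) (k : ℕ), v ^ (k + k) = 1 := fun v k => by
    rw [← two_mul, pow_mul, hV, one_pow]
  have hmul : ∀ v v' : V, v ≠ v' → v * v' ≠ 1 := fun v v' hne he =>
    hne (by rw [eq_inv_of_mul_eq_one_left he, hinv])
  -- Only the parities of the exponents matter, and the product of two distinct elements is never
  -- trivial, so the relations depend only on which element is `1`.
  refine hh _ _ _ _ fun w => ?_
  obtain ⟨i, j, h1, h2⟩ := exists_lift_eq_pow hV p p' q q' w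
  rw [h1, h2]
  rcases Nat.even_or_odd i with ⟨i, rfl⟩ | ⟨i, rfl⟩ <;>
    rcases Nat.even_or_odd j with ⟨j, rfl⟩ | ⟨j, rfl⟩ <;>
    simp only [hodd, heven, one_mul, mul_one, h, h', hmul p p' hp, hmul q q' hq]

/-- Because `c.1 = d.1`, the `U`-coordinate of `φ (a ^ j)` is `c.1 ^ j` whatever the labels. The
power of two needed to kill `a.2` is cancelled in the odd group `U`. -/
theorem LocalIso.pow_fst_eq_one {U : Type*} [CommGroup U] [Finite U] (hU : Odd (Nat.card U))
    {V : Type*} [Group V] {φ : U × V → U × V} {a b c d : U × V} (h : LocalIso φ a b c d)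
    (hcd : c.1 = d.1) {k : ℕ} (hV : a.2 ^ 2 ^ k = 1) {m : ℕ} (hm : a.1 ^ m = 1) :
    c.1 ^ m = 1 := by
  have key : ∀ j : ℕ, (φ (a ^ j)).1 = c.1 ^ j := by
    intro j
    induction j with
    | zero => simp [h.map_one]
    | succ j ih =>
      rw [pow_succ', pow_succ']
      rcases h.map_left_mem (pow_mem left_mem_closure_pair j) with h1 | h1 <;>
        rw [h1, Prod.fst_mul, ih]
      rw [hcd]
  have ha : a ^ (m * 2 ^ k) = 1 := by
    ext
    · rw [Prod.pow_fst, pow_mul, hm, one_pow, Prod.fst_one]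
    · rw [Prod.pow_snd, mul_comm, pow_mul, hV, one_pow, Prod.snd_one]
  have := key (m * 2 ^ k)
  rw [ha, h.map_one, Prod.fst_one, pow_mul] at this
  exact (pow_pow_two_eq_one_iff hU k).1 this.symm

theorem orderOf_eq_of_pow_iff {U : Type*} [Group U] {x y : U}
    (h : ∀ m : ℕ, x ^ m = 1 → y ^ m = 1) (h' : ∀ m : ℕ, y ^ m = 1 → x ^ m = 1) :
    orderOf x = orderOf y :=
  Nat.dvd_antisymm (orderOf_dvd_of_pow_eq_one (h' _ (pow_orderOf_eq_one y)))
    (orderOf_dvd_of_pow_eq_one (h _ (pow_orderOf_eq_one x)))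

variable {U : Type*} [CommGroup U]

/-- If `a.2 = 1`, an odd power of `a` is trivial, while the `V`-coordinate of its image is `c.2` or
`d.2`. -/
theorem LocalIso.snd_eq_one (hU : Odd (Nat.card U)) (hV : ∀ v : V, v ^ 2 = 1)
    {φ : U × V → U × V} {a b c d : U × V} (h : LocalIso φ a b c d)
    (hcd : c.1 = d.1) (ha : a.2 = 1) : c.2 = 1 ∨ d.2 = 1 := by
  obtain ⟨k, hk⟩ := hU
  have hpow : a ^ (2 * k + 1) = 1 := by
    ext
    · rw [Prod.pow_fst, ← hk, pow_card_eq_one', Prod.fst_one]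
    · rw [Prod.pow_snd, ha, one_pow, Prod.snd_one]
  have hodd : ∀ v : V, v ^ (2 * k + 1) = v := fun v => by
    rw [pow_succ, pow_mul, hV, one_pow, one_mul]
  have hw : d * c⁻¹ * (d * c⁻¹) = 1 := by
    ext
    · simp [hcd]
    · have := hV (d.2 * c.2⁻¹)
      rwa [pow_two] at this
  have := h.map_pow_left hw (mul_comm _ _) (by rw [inv_mul_cancel_right]) (2 * k + 1)
  rw [hpow, h.map_one] at this
  rcases this with h1 | h1
  · left
    have := congrArg Prod.snd h1
    rwa [Prod.pow_snd, hodd, Prod.snd_one, eq_comm] at this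
  · right
    have := congrArg Prod.snd h1
    rwa [Prod.snd_mul, Prod.pow_snd, hodd, Prod.snd_mul, Prod.snd_inv, inv_mul_cancel_right,
      Prod.snd_one, eq_comm] at this

theorem locallyRigid_of_exponent_two [Finite U] [Finite V] (hU : Odd (Nat.card U)) (hV : ∀ v : V, v ^ 2 = 1)
    (hhU : PairHomogeneous U) (hhV : PairHomogeneous V) (hh : PairHomogeneous (U × V)) :
    LocallyRigid (U × V) := by
  refine .of_commGroup hh fun φ φ' a b c d hab hcd h h' hsq hsq' => ?_
  have e1 : a.1 = b.1 := eq_of_sq_eq_of_odd hU (congrArg Prod.fst hsq)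
  have e2 : c.1 = d.1 := eq_of_sq_eq_of_odd hU (congrArg Prod.fst hsq')
  have n1 : a.2 ≠ b.2 := fun h => hab (Prod.ext e1 h)
  have n2 : c.2 ≠ d.2 := fun h => hcd (Prod.ext e2 h)
  obtain ⟨β, hβ⟩ := hhU.exists_of_orderOf_eq (orderOf_eq_of_pow_iff
    (fun m => h.pow_fst_eq_one hU e2 (k := 1) (hV _))
    (fun m => h'.pow_fst_eq_one hU e1 (k := 1) (hV _)))
  have i1 : a.2 = 1 → c.2 = 1 ∨ d.2 = 1 := h.snd_eq_one hU hV e2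
  have i2 : b.2 = 1 → c.2 = 1 ∨ d.2 = 1 := h.swap_left.snd_eq_one hU hV e2
  have i3 : c.2 = 1 → a.2 = 1 ∨ b.2 = 1 := h'.snd_eq_one hU hV e1
  have i4 : d.2 = 1 → a.2 = 1 ∨ b.2 = 1 := h'.swap_left.snd_eq_one hU hV e1
  have n1' : ¬ (a.2 = 1 ∧ b.2 = 1) := fun h => n1 (h.1.trans h.2.symm)
  have n2' : ¬ (c.2 = 1 ∧ d.2 = 1) := fun h => n2 (h.1.trans h.2.symm)
  have hcase : ((a.2 = 1 ↔ c.2 = 1) ∧ (b.2 = 1 ↔ d.2 = 1)) ∨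
      ((a.2 = 1 ↔ d.2 = 1) ∧ (b.2 = 1 ↔ c.2 = 1)) := by tauto
  rcases hcase with ⟨j1, j2⟩ | ⟨j1, j2⟩
  · obtain ⟨γ, hγ⟩ := hhV.exists_of_exponent_two hV n1 n2 j1 j2
    exact ⟨β.prodCongr γ, Or.inl ⟨Prod.ext hβ hγ.1,
      Prod.ext ((congrArg β e1.symm).trans (hβ.trans e2)) hγ.2⟩⟩
  · obtain ⟨γ, hγ⟩ := hhV.exists_of_exponent_two hV n1 n2.symm j1 j2
    exact ⟨β.prodCongr γ, Or.inr ⟨Prod.ext (hβ.trans e2) hγ.1,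
      Prod.ext ((congrArg β e1.symm).trans hβ) hγ.2⟩⟩

end exponentTwo

/-! ### Products of an odd abelian group with `Q₈` -/

section quaternion

/-- Squares in `Q₈` are central. -/
theorem quaternion_sq_comm : ∀ q r : QuaternionGroup 2, q * q * r = r * (q * q) := by decide +kernel

theorem quaternion_sq_eq : ∀ q r : QuaternionGroup 2, q * r ≠ r * q → q * q = r * r := by
  decide +kernel

theorem quaternion_words_ne : ∀ q r : QuaternionGroup 2, q * r ≠ r * q →
    q * q * r ≠ q * q * q ∧ q * q * r ≠ r * r * q ∧ q * q * r ≠ q * r * q ∧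
    r * q * r ≠ r * q * q ∧ r * q * r ≠ q * q * q ∧ r * q * r ≠ r * r * q ∧
    r * q * r ≠ q * r * q ∧ r * r * r ≠ q * q * q := by
  decide +kernel

theorem quaternion_sq_of_comm : ∀ q r : QuaternionGroup 2, q * r = r * q →
    q * q = 1 ∨ r * r = 1 ∨ q * q = r * r := by decide +kernel

theorem quaternion_mul_sq : ∀ q r : QuaternionGroup 2, q * r * (q * r) = r * q * (r * q) := by
  decide +kernel

theorem quaternion_pow_eight : ∀ q : QuaternionGroup 2, q ^ 2 ^ 3 = 1 := by decide +kernel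

theorem quaternion_atMostOneInvolution : AtMostOneInvolution (QuaternionGroup 2) := by
  unfold AtMostOneInvolution
  decide +kernel

theorem quaternion_exists_mulEquiv_inv : ∀ q r : QuaternionGroup 2, ∃ g : QuaternionGroup 2,
    g * q * g⁻¹ = q⁻¹ ∧ g * r * g⁻¹ = r⁻¹ := by decide +kernel

theorem quaternion_card : Nat.card (QuaternionGroup 2) = 2 ^ 3 := by
  rw [Nat.card_eq_fintype_card, QuaternionGroup.card]
  norm_num

theorem quaternion_exists_mulEquiv {q r q' r' : QuaternionGroup 2} (h : q * r ≠ r * q)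
    (h' : q' * r' ≠ r' * q') :
    ∃ α : QuaternionGroup 2 ≃* QuaternionGroup 2, α q = q' ∧ α r = r' := by
  have key : ∀ x y : QuaternionGroup 2,
      quaternionMap x y (.a 1) = x ∧ quaternionMap x y (.xa 0) = y := by decide +kernel
  obtain ⟨α, hα⟩ := exists_quaternion_mulEquiv h
  obtain ⟨β, hβ⟩ := exists_quaternion_mulEquiv h'
  have e1 : α.symm q = .a 1 := by rw [MulEquiv.symm_apply_eq, hα, (key q r).1]
  have e2 : α.symm r = .xa 0 := by rw [MulEquiv.symm_apply_eq, hα, (key q r).2]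
  exact ⟨α.symm.trans β, by rw [MulEquiv.trans_apply, e1, hβ, (key q' r').1],
    by rw [MulEquiv.trans_apply, e2, hβ, (key q' r').2]⟩

end quaternion

section

variable {U : Type*} [CommGroup U] {a b c d : U × QuaternionGroup 2}

theorem snd_not_comm (h : c * d ≠ d * c) : c.2 * d.2 ≠ d.2 * c.2 :=
  fun he => h (Prod.ext (mul_comm _ _) he)

theorem sq_mul_comm (c d : U × QuaternionGroup 2) : c * c * d = d * (c * c) :=
  Prod.ext (mul_comm _ _) (quaternion_sq_comm _ _)

variable {φ : U × QuaternionGroup 2 → U × QuaternionGroup 2}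

/-- Comparison of the two paths `b, a, a` and `a, a, b`, which have the same end point: either all
the steps keep the labelling, or it is flipped exactly after the first step. -/
theorem LocalIso.step_aab (h : LocalIso φ a b c d) (hcd : c * d ≠ d * c) (hsq : c * c ≠ d * d)
    {x : U × QuaternionGroup 2} (hx : x ∈ Subgroup.closure {a, b}) (hs : ArcStep φ a b c d x) :
    (ArcStep φ a b c d (a * x) ∧ ArcStep φ a b c d (b * x) ∧
      ArcStep φ a b c d (a * (a * x)) ∧ ArcStep φ a b c d (a * (b * x))) ∨
    (ArcStep φ a b d c (a * x) ∧ ArcStep φ a b d c (b * x) ∧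
      ArcStep φ a b c d (a * (a * x)) ∧ ArcStep φ a b c d (a * (b * x))) := by
  have hax := left_mul_mem hx
  have hbx := right_mul_mem hx
  have hs2 := snd_not_comm hcd
  obtain ⟨q1, q2, q3, q4, q5, q6, q7, q8⟩ := quaternion_words_ne _ _ hs2
  obtain ⟨r1, r2, r3, r4, r5, r6, r7, r8⟩ := quaternion_words_ne _ _ hs2.symm
  have f : φ (a * (a * (b * x))) = φ (b * (a * (a * x))) := by
    congr 1
    simp only [← mul_assoc]
    rw [sq_mul_comm, ← mul_assoc]
  have n1 : c * d * d ≠ c * c * c := fun he => by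
    rw [mul_assoc, mul_assoc] at he
    exact hsq (mul_left_cancel he).symm
  have n2 : d * d * d ≠ d * c * c := fun he => by
    rw [mul_assoc, mul_assoc] at he
    exact hsq (mul_left_cancel he).symm
  have s1 := quaternion_sq_comm c.2 d.2
  have s2 := quaternion_sq_comm d.2 c.2
  rw [← mul_assoc] at s1 s2
  rcases h.step _ hax with h1 | h1 <;> rcases h.step _ hbx with h2 | h2 <;>
    rcases h.step _ (left_mul_mem hax) with h3 | h3 <;>
    rcases h.step _ (left_mul_mem hbx) with h4 | h4 <;>
    first
    | exact Or.inl ⟨h1, h2, h3, h4⟩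
    | exact Or.inr ⟨h1, h2, h3, h4⟩
    | exfalso
      rw [h3.2, h4.1, h1.1, h2.1, hs.1, hs.2] at f
      simp only [← mul_assoc] at f
      have f1 := mul_right_cancel f
      first
      | exact n1 f1
      | exact n2 f1
      | have f2 := congrArg Prod.snd f1
        simp only [Prod.snd_mul] at f2
        grind

theorem LocalIso.step_dichotomy (h : LocalIso φ a b c d) (hcd : c * d ≠ d * c)
    (hsq : c * c ≠ d * d) {x : U × QuaternionGroup 2} (hx : x ∈ Subgroup.closure {a, b})
    (hs : ArcStep φ a b c d x) :
    (ArcStep φ a b c d (a * x) ∧ ArcStep φ a b c d (b * x) ∨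
      ArcStep φ a b d c (a * x) ∧ ArcStep φ a b d c (b * x)) ∧
      ArcStep φ a b c d (a * (a * x)) ∧ ArcStep φ a b c d (a * (b * x)) ∧
      ArcStep φ a b c d (b * (a * x)) ∧ ArcStep φ a b c d (b * (b * x)) := by
  have h1 := h.step_aab hcd hsq hx hs
  have hx' := hx
  rw [Set.pair_comm] at hx'
  have h2 := h.swap_left.swap_right.step_aab hcd.symm hsq.symm hx' hs.symm
  refine ⟨h1.imp (fun h => ⟨h.1, h.2.1⟩) (fun h => ⟨h.1, h.2.1⟩), ?_, ?_, ?_, ?_⟩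
  · rcases h1 with h1 | h1 <;> exact h1.2.2.1
  · rcases h1 with h1 | h1 <;> exact h1.2.2.2
  · rcases h2 with h2 | h2 <;> exact h2.2.2.2.symm
  · rcases h2 with h2 | h2 <;> exact h2.2.2.1.symm

/-- Otherwise the labels alternate along paths, and the identity `abab = baba` is carried to `d⁴ =
c⁴` in the `U`-coordinate. As `U` is odd and non-commuting elements of `Q₈` have equal squares, this
forces `c² = d²`. -/
theorem LocalIso.not_flip [Finite U] (hU : Odd (Nat.card U)) (h : LocalIso φ a b c d)
    (hcd : c * d ≠ d * c) (hsq : c * c ≠ d * d) (hs : ArcStep φ a b c d 1) :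
    ¬ (ArcStep φ a b d c (a * 1) ∧ ArcStep φ a b d c (b * 1)) := by
  rintro ⟨ha, hb⟩
  have m1 := one_mem (Subgroup.closure {a, b})
  obtain ⟨-, -, hab, hba, -⟩ := h.step_dichotomy hcd hsq m1 hs
  have flip : ∀ {x}, x ∈ Subgroup.closure {a, b} → ArcStep φ a b d c x →
      ArcStep φ a b d c (a * (b * x)) ∧ ArcStep φ a b d c (b * (a * x)) := fun hx hs' =>
    have := h.swap_right.step_dichotomy hcd.symm hsq.symm hx hs'
    ⟨this.2.2.1, this.2.2.2.1⟩
  have haba := (flip (left_mul_mem m1) ha).1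
  have hbab := (flip (right_mul_mem m1) hb).2
  have e : a * (b * (a * (b * 1))) = b * (a * (b * (a * 1))) := by
    simp only [mul_one]
    refine Prod.ext ?_ ?_
    · simp only [Prod.fst_mul]
      rw [mul_left_comm, mul_comm a.1 b.1]
    · have := quaternion_mul_sq a.2 b.2
      simpa only [Prod.snd_mul, mul_assoc] using this
  have f := congrArg φ e
  rw [hbab.1, haba.2, hab.2, hba.1, hb.1, ha.2, hs.1, hs.2, h.map_one, mul_one, mul_one] at f
  have f1 : d.1 * d.1 * (d.1 * d.1) = c.1 * c.1 * (c.1 * c.1) := by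
    have := congrArg Prod.fst f
    simpa only [Prod.fst_mul, mul_assoc] using this
  refine hsq (Prod.ext ?_ ?_)
  · exact (eq_of_sq_eq_of_odd hU f1).symm
  · exact quaternion_sq_eq _ _ (snd_not_comm hcd)

theorem LocalIso.pairConj_of_not_comm_of_step [Finite U] (hU : Odd (Nat.card U))
    (hh : PairHomogeneous (U × QuaternionGroup 2)) (h : LocalIso φ a b c d)
    (hcd : c * d ≠ d * c) (hsq : c * c ≠ d * d) (hs : ArcStep φ a b c d 1) :
    PairConj a b c d := by
  have hne : c ≠ d := fun he => hcd (by rw [he])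
  have hkeep : ∀ {x}, ArcStep φ a b c d x → ¬ ArcStep φ a b d c x :=
    fun h1 h2 => hne (h1.eq_of_swap h2)
  -- The induction carries the labels at `x`, `a * x` and `b * x` together, since the dichotomy
  -- determines labels two steps ahead.
  refine h.pairConj_of_step hh fun x hx => And.left
    (b := ArcStep φ a b c d (a * x) ∧ ArcStep φ a b c d (b * x)) ?_
  refine closure_pair_induction (p := fun x => ArcStep φ a b c d x ∧ ArcStep φ a b c d (a * x) ∧
    ArcStep φ a b c d (b * x)) ?_ ?_ ?_ hx
  · rcases (h.step_dichotomy hcd hsq (one_mem _) hs).1 with h1 | h1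
    · exact ⟨hs, h1⟩
    · exact absurd h1 (h.not_flip hU hcd hsq hs)
  · rintro y hy ⟨h1, h2, h3⟩
    obtain ⟨-, h4, h5, h6, h7⟩ := h.step_dichotomy hcd hsq hy h1
    exact ⟨h2, h4, h6⟩
  · rintro y hy ⟨h1, h2, h3⟩
    obtain ⟨-, h4, h5, h6, h7⟩ := h.step_dichotomy hcd hsq hy h1
    exact ⟨h3, h5, h7⟩

theorem LocalIso.sq_eq_of_sq_eq (h : LocalIso φ a b c d) (hcd : c * d ≠ d * c)
    (hsq : a * a = b * b) : c * c = d * d := by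
  have hne : c ≠ d := fun he => hcd (by rw [he])
  have m1 := one_mem (Subgroup.closure {a, b})
  have f : φ (a * (a * 1)) = φ (b * (b * 1)) := by rw [mul_one, mul_one, hsq]
  have e1 : d * d ≠ d * c := fun he => hne (mul_left_cancel he).symm
  have e2 : c * c ≠ c * d := fun he => hne (mul_left_cancel he)
  have e3 : c * c ≠ d * c := fun he => hne (mul_right_cancel he)
  have e4 : d * d ≠ c * d := fun he => hne (mul_right_cancel he).symm
  rcases h.step _ m1 with h1 | h1 <;> rcases h.step _ (left_mul_mem m1) with h2 | h2 <;>
    rcases h.step _ (right_mul_mem m1) with h3 | h3 <;>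
    rw [h2.1, h3.2, h1.1, h1.2, h.map_one, mul_one, mul_one] at f <;>
    first
    | exact f
    | exact f.symm
    | exact absurd f hcd
    | exact absurd f.symm hcd
    | exact absurd f e1
    | exact absurd f e2
    | exact absurd f e3
    | exact absurd f e4
    | exact absurd f.symm e1
    | exact absurd f.symm e2

/-- If the squares agree, the `U`-coordinates agree within each pair and the two coordinates can be
matched independently; otherwise the labels are constant. -/
theorem pairConj_of_not_comm [Finite U] (hU : Odd (Nat.card U))
    (hhU : PairHomogeneous U) (hh : PairHomogeneous (U × QuaternionGroup 2))
    {φ' : U × QuaternionGroup 2 → U × QuaternionGroup 2}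
    (h : LocalIso φ a b c d) (h' : LocalIso φ' c d a b)
    (hab : a * b ≠ b * a) (hcd : c * d ≠ d * c) : PairConj a b c d := by
  by_cases hsq' : c * c = d * d
  · have hsq := h'.sq_eq_of_sq_eq hab hsq'
    have e1 : a.1 = b.1 := eq_of_sq_eq_of_odd hU (congrArg Prod.fst hsq)
    have e2 : c.1 = d.1 := eq_of_sq_eq_of_odd hU (congrArg Prod.fst hsq')
    obtain ⟨β, hβ⟩ := hhU.exists_of_orderOf_eq (orderOf_eq_of_pow_iff
      (fun m => h.pow_fst_eq_one hU e2 (quaternion_pow_eight _))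
      (fun m => h'.pow_fst_eq_one hU e1 (quaternion_pow_eight _)))
    obtain ⟨γ, hγ⟩ := quaternion_exists_mulEquiv (snd_not_comm hab) (snd_not_comm hcd)
    exact ⟨β.prodCongr γ, Or.inl ⟨Prod.ext hβ hγ.1,
      Prod.ext ((congrArg β e1.symm).trans (hβ.trans e2)) hγ.2⟩⟩
  · rcases h.step 1 (one_mem _) with h1 | h1
    · exact h.pairConj_of_not_comm_of_step hU hh hcd hsq' h1
    · exact (h.swap_right.pairConj_of_not_comm_of_step hU hh hcd.symm
        (fun h => hsq' h.symm) h1).swap_right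

/-- The paths `ab` and `ba` from `x` have the same end; as `c` and `d` do not commute, their images
can meet only if the labels flip at both intermediate vertices. -/
theorem LocalIso.step_flip_of_comm (h : LocalIso φ a b c d) (hab : a * b = b * a)
    (hcd : c * d ≠ d * c) {x : U × QuaternionGroup 2} (hx : x ∈ Subgroup.closure {a, b})
    (hs : ArcStep φ a b c d x) : ArcStep φ a b d c (a * x) ∧ ArcStep φ a b d c (b * x) := by
  have hne : c ≠ d := fun he => hcd (by rw [he])
  have f : φ (a * (b * x)) = φ (b * (a * x)) := by rw [← mul_assoc, hab, mul_assoc]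
  rcases h.step _ (left_mul_mem hx) with h2 | h2 <;>
    rcases h.step _ (right_mul_mem hx) with h3 | h3
  · rw [h3.1, h2.2, hs.1, hs.2, ← mul_assoc, ← mul_assoc] at f
    exact absurd (mul_right_cancel f) hcd
  · rw [h3.1, h2.2, hs.1, hs.2, ← mul_assoc, ← mul_assoc] at f
    exact absurd (mul_left_cancel (mul_right_cancel f)).symm hne
  · rw [h3.1, h2.2, hs.1, hs.2, ← mul_assoc, ← mul_assoc] at f
    exact absurd (mul_left_cancel (mul_right_cancel f)).symm hne
  · exact ⟨h2, h3⟩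

theorem LocalIso.map_pow_of_comm (h : LocalIso φ a b c d) (hab : a * b = b * a)
    (hcd : c * d ≠ d * c) (hs : ArcStep φ a b c d 1) (k : ℕ) :
    φ ((a * a) ^ k) = (d * c) ^ k ∧ ArcStep φ a b c d ((a * a) ^ k) := by
  induction k with
  | zero => simpa using ⟨h.map_one, hs⟩
  | succ k ih =>
    have hm : (a * a) ^ k ∈ Subgroup.closure {a, b} :=
      pow_mem (mul_mem left_mem_closure_pair left_mem_closure_pair) k
    have h1 := (h.step_flip_of_comm hab hcd hm ih.2).1
    have h2 := (h.swap_right.step_flip_of_comm hab hcd.symm (left_mul_mem hm) h1).1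
    rw [pow_succ', mul_assoc, pow_succ', mul_assoc]
    exact ⟨by rw [h1.1, ih.2.1, ih.1], h2⟩

/-- Otherwise `(a * a) ^ |U|` is trivial, hence so is its image `(d * c) ^ |U|`. Then `d.2 * c.2 =
1` because `|U|` is odd, so `c.2` and `d.2` commute. -/
theorem LocalIso.snd_sq_ne_one [Finite U] (hU : Odd (Nat.card U)) (h : LocalIso φ a b c d)
    (hab : a * b = b * a) (hcd : c * d ≠ d * c) (hs : ArcStep φ a b c d 1) :
    a.2 * a.2 ≠ 1 := by
  intro ha
  have h1 : (a * a) ^ Nat.card U = 1 := by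
    ext
    · rw [Prod.pow_fst, pow_card_eq_one', Prod.fst_one]
    · rw [Prod.pow_snd, Prod.snd_mul, ha, one_pow, Prod.snd_one]
  have h2 := (h.map_pow_of_comm hab hcd hs (Nat.card U)).1
  rw [h1, h.map_one] at h2
  have h3 : (d.2 * c.2) ^ Nat.card U = 1 := (congrArg Prod.snd h2).symm
  rw [pow_eq_one_iff_of_card_coprime] at h3
  · exact snd_not_comm hcd (by rw [h3, eq_inv_of_mul_eq_one_left h3, mul_inv_cancel])
  · rw [quaternion_card]
    exact Nat.Coprime.pow_left 3 (Nat.coprime_two_left.2 hU)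

theorem LocalIso.not_comm_of_step [Finite U] (hU : Odd (Nat.card U)) (h : LocalIso φ a b c d)
    (hcd : c * d ≠ d * c) (hs : ArcStep φ a b c d 1) : a * b ≠ b * a := by
  intro hab
  rcases quaternion_sq_of_comm _ _ (congrArg Prod.snd hab) with h1 | h1 | h1
  · exact h.snd_sq_ne_one hU hab hcd hs h1
  · exact h.swap_left.swap_right.snd_sq_ne_one hU hab.symm hcd.symm hs.symm h1
  -- Here `φ(a⁴) = (dc)² = (cd)² = φ(b⁴)`, so `a⁴ = b⁴`. Together with `h1` this gives `a² = b²`,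
  -- whose images are `dc` and `cd`.
  · have f1 := fun k => (h.map_pow_of_comm hab hcd hs k).1
    have f2 := fun k =>
      (h.swap_left.swap_right.map_pow_of_comm hab.symm hcd.symm hs.symm k).1
    have e : (d * c) ^ 2 = (c * d) ^ 2 := by
      rw [pow_two, pow_two]
      refine Prod.ext ?_ (quaternion_mul_sq _ _)
      simp only [Prod.fst_mul, mul_comm d.1]
    have ma : a ∈ Subgroup.closure {a, b} := left_mem_closure_pair
    have mb : b ∈ Subgroup.closure {a, b} := right_mem_closure_pair
    have e' : (a * a) ^ 2 = (b * b) ^ 2 :=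
      h.injOn (pow_mem (mul_mem ma ma) 2) (pow_mem (mul_mem mb mb) 2) (by rw [f1, f2, e])
    rw [pow_two, pow_two] at e'
    have e1 : a.1 * a.1 = b.1 * b.1 := eq_of_sq_eq_of_odd hU (congrArg Prod.fst e')
    have e2 : a * a = b * b := Prod.ext e1 h1
    have g1 := f1 1
    have g2 := f2 1
    rw [pow_one, pow_one] at g1 g2
    exact hcd (by rw [← g1, ← g2, e2])

theorem LocalIso.not_comm [Finite U] (hU : Odd (Nat.card U)) (h : LocalIso φ a b c d)
    (hcd : c * d ≠ d * c) : a * b ≠ b * a := by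
  rcases h.step 1 (one_mem _) with h1 | h1
  · exact h.not_comm_of_step hU hcd h1
  · exact h.swap_right.not_comm_of_step hU hcd.symm h1

theorem locallyRigid_prod_quaternion [Finite U] (hU : Odd (Nat.card U))
    (hhU : PairHomogeneous U) (hh : PairHomogeneous (U × QuaternionGroup 2)) :
    LocallyRigid (U × QuaternionGroup 2) := by
  intro φ φ' a b c d hab hcd h h'
  by_cases h1 : a * b = b * a
  · by_cases h2 : c * d = d * c
    · by_cases h3 : a * a = b * b
      · by_cases h4 : c * c = d * d
        · exact pairConj_of_atMostOneInvolution hh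
            (atMostOneInvolution_prod hU quaternion_atMostOneInvolution) h h' h1 h2 hab hcd h3 h4
        · obtain ⟨α, hα⟩ := h'.pairConj_of_comm hh h2 h1 hcd h4
          refine ⟨α.symm, hα.imp ?_ ?_⟩
          · rintro ⟨rfl, rfl⟩; simp
          · rintro ⟨rfl, rfl⟩; simp
      · exact h.pairConj_of_comm hh h1 h2 hab h3
    · exact absurd h1 (h.not_comm hU h2)
  · by_cases h2 : c * d = d * c
    · exact absurd h2 (h'.not_comm hU h1)
    · exact pairConj_of_not_comm hU hhU hh h h' h1 h2

end

/-! ### From bi-Cayley graphs to local isomorphisms -/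

section graph

variable {G : Type*} [Group G] {S T : Set G}

theorem bcay_adj_zero {x : G} {v : G × Fin 2} :
    (bcay S).Adj (x, 0) v ↔ ∃ s ∈ S, v = (s * x, 1) := by
  constructor
  · rintro ⟨y, s, hs, ⟨h, rfl⟩ | ⟨h, rfl⟩⟩
    · obtain rfl := congrArg Prod.fst h
      exact ⟨s, hs, rfl⟩
    · exact absurd (congrArg Prod.snd h) (by simp)
  · rintro ⟨s, hs, rfl⟩
    exact ⟨x, s, hs, Or.inl ⟨rfl, rfl⟩⟩

theorem snd_ne_of_bcay_adj {v w : G × Fin 2} (h : (bcay S).Adj v w) : v.2 ≠ w.2 := by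
  obtain ⟨x, s, hs, ⟨rfl, rfl⟩ | ⟨rfl, rfl⟩⟩ := h <;> simp

theorem snd_eq_of_common_neighbor {u v w : G × Fin 2} (h : (bcay S).Adj v u)
    (h' : (bcay S).Adj w u) : v.2 = w.2 := by
  have h1 := snd_ne_of_bcay_adj h
  have h2 := snd_ne_of_bcay_adj h'
  omega

/-- Right multiplication as an automorphism of a bi-Cayley graph. -/
def bcayRight (S : Set G) (g : G) : bcay S ≃g bcay S where
  toEquiv := (Equiv.mulRight g).prodCongr (Equiv.refl _)
  map_rel_iff' := by
    rintro ⟨x, i⟩ ⟨y, j⟩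
    constructor
    · rintro ⟨z, s, hs, h⟩
      simp only [Equiv.prodCongr_apply, Prod.map_apply, Equiv.coe_mulRight, Equiv.refl_apply,
        Prod.mk.injEq] at h
      refine ⟨z * g⁻¹, s, hs, h.imp ?_ ?_⟩ <;> rintro ⟨⟨h1, rfl⟩, ⟨h2, rfl⟩⟩
      · rw [← mul_assoc, ← h2, ← h1, mul_inv_cancel_right, mul_inv_cancel_right]
        exact ⟨rfl, rfl⟩
      · rw [← mul_assoc, ← h1, ← h2, mul_inv_cancel_right, mul_inv_cancel_right]
        exact ⟨rfl, rfl⟩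
    · rintro ⟨z, s, hs, h⟩
      refine ⟨z * g, s, hs, h.imp ?_ ?_⟩ <;>
      · rintro ⟨h1, h2⟩
        simp [h1, h2, mul_assoc]

@[simp]
theorem bcayRight_apply (S : Set G) (g x : G) (i : Fin 2) :
    bcayRight S g (x, i) = (x * g, i) := rfl

/-- The involution of the two sides given by an automorphism inverting `s₀⁻¹ * S`. -/
theorem exists_bcay_swap {s₀ : G} (α : G ≃* G)
    (hα : ∀ s ∈ S, α (s₀⁻¹ * s) = (s₀⁻¹ * s)⁻¹) :
    ∃ σ : bcay S ≃g bcay S, ∀ x, (∃ y, σ (x, 0) = (y, 1)) ∧ ∃ y, σ (x, 1) = (y, 0) := by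
  let e : G × Fin 2 ≃ G × Fin 2 :=
    { toFun := fun v => if v.2 = 0 then (s₀ * α v.1, 1) else (α (s₀⁻¹ * v.1), 0)
      invFun := fun v => if v.2 = 0 then (s₀ * α.symm v.1, 1) else (α.symm (s₀⁻¹ * v.1), 0)
      left_inv := by rintro ⟨x, i⟩; fin_cases i <;> simp
      right_inv := by rintro ⟨x, i⟩; fin_cases i <;> simp }
  have e0 : ∀ x, e (x, 0) = (s₀ * α x, 1) := fun x => rfl
  have e1 : ∀ x, e (x, 1) = (α (s₀⁻¹ * x), 0) := fun x => rfl
  have key : ∀ x y, (bcay S).Adj (e (x, 0)) (e (y, 1)) ↔ (bcay S).Adj (x, 0) (y, 1) := by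
    intro x y
    rw [SimpleGraph.adj_comm, e0, e1, bcay_adj_zero, bcay_adj_zero]
    constructor
    · rintro ⟨s, hs, h⟩
      refine ⟨s, hs, Prod.ext ?_ rfl⟩
      have h1 : s₀ * α x = s * α (s₀⁻¹ * y) := congrArg Prod.fst h
      have h2 : α x = s₀⁻¹ * s * α (s₀⁻¹ * y) := by rw [mul_assoc, ← h1, inv_mul_cancel_left]
      have h3 : s₀⁻¹ * s = α (s₀⁻¹ * s)⁻¹ := by rw [map_inv, hα s hs, inv_inv]
      rw [h3, ← map_mul] at h2
      have h4 := α.injective h2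
      show y = s * x
      rw [h4]
      group
    · rintro ⟨s, hs, h⟩
      obtain rfl : y = s * x := congrArg Prod.fst h
      refine ⟨s, hs, Prod.ext ?_ rfl⟩
      show s₀ * α x = s * α (s₀⁻¹ * (s * x))
      rw [← mul_assoc s₀⁻¹, map_mul, hα s hs]
      group
  have n0 : ∀ x y, ¬ (bcay S).Adj (x, 0) (y, 0) := fun x y h => snd_ne_of_bcay_adj h rfl
  have n1 : ∀ x y, ¬ (bcay S).Adj (x, 1) (y, 1) := fun x y h => snd_ne_of_bcay_adj h rfl
  refine ⟨⟨e, ?_⟩, fun x => ⟨⟨_, e0 x⟩, ⟨_, e1 x⟩⟩⟩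
  rintro ⟨x, i⟩ ⟨y, j⟩
  fin_cases i <;> fin_cases j
  · exact iff_of_false (n1 _ _) (n0 _ _)
  · exact key x y
  · exact ((bcay S).adj_comm _ _).trans ((key y x).trans ((bcay S).adj_comm _ _))
  · exact iff_of_false (n0 _ _) (n1 _ _)

/-- If some automorphism swaps the sides and the stabiliser of `(1, 0)` is transitive on its
neighbours, the graph is arc-transitive. -/
theorem isArcTransitive_bcay (σ : bcay S ≃g bcay S)
    (hσ : ∀ x, ∃ y, σ (x, 1) = (y, 0))
    (h : ∀ s ∈ S, ∀ s' ∈ S, ∃ θ : bcay S ≃g bcay S, θ (1, 0) = (1, 0) ∧ θ (s, 1) = (s', 1)) :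
    IsArcTransitive (bcay S) := by
  have norm : ∀ v w, (bcay S).Adj v w →
      ∃ θ : bcay S ≃g bcay S, ∃ s ∈ S, θ v = (1, 0) ∧ θ w = (s, 1) := by
    have norm0 : ∀ x w, (bcay S).Adj (x, 0) w →
        ∃ θ : bcay S ≃g bcay S, ∃ s ∈ S, θ (x, 0) = (1, 0) ∧ θ w = (s, 1) := by
      intro x w hw
      obtain ⟨s, hs, rfl⟩ := bcay_adj_zero.1 hw
      exact ⟨bcayRight S x⁻¹, s, hs, by simp, by simp⟩
    rintro ⟨x, i⟩ w hw
    fin_cases i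
    · exact norm0 x w hw
    · obtain ⟨y, hy⟩ := hσ x
      have h1 : (bcay S).Adj (y, 0) (σ w) := by
        rw [← hy]
        exact σ.map_adj_iff.2 hw
      obtain ⟨θ, s, hs, h2, h3⟩ := norm0 _ _ h1
      refine ⟨σ.trans θ, s, hs, ?_, h3⟩
      show θ (σ (x, 1)) = (1, 0)
      rw [hy, h2]
  intro v w v' w' hvw hvw'
  obtain ⟨θ, s, hs, h1, h2⟩ := norm v w hvw
  obtain ⟨θ', s', hs', h1', h2'⟩ := norm v' w' hvw'
  obtain ⟨η, h3, h4⟩ := h s hs s' hs'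
  refine ⟨(θ.trans η).trans θ'.symm, ?_, ?_⟩
  · show θ'.symm (η (θ v)) = v'
    rw [h1, h3, ← h1']
    exact θ'.symm_apply_apply v'
  · show θ'.symm (η (θ w)) = w'
    rw [h2, h4, ← h2']
    exact θ'.symm_apply_apply w'

/-- An equivalence relation on a three-element set with at least two classes has a singleton
class. -/
theorem exists_isolated {α : Type*} {S : Set α} (hS : S.ncard = 3) {r : α → α → Prop}
    (hr : Equivalence r) (h : ¬ ∀ s ∈ S, ∀ s' ∈ S, r s s') :
    ∃ s₀ s₁ s₂, S = {s₀, s₁, s₂} ∧ s₁ ≠ s₂ ∧ ∀ s ∈ S, r s₀ s → s = s₀ := by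
  obtain ⟨x, y, z, hxy, hxz, hyz, rfl⟩ := Set.ncard_eq_three.1 hS
  by_contra! hcon
  have c1 := hcon x y z rfl hyz
  have c2 := hcon y x z (Set.insert_comm _ _ _) hxz
  have c3 := hcon z x y (by ext; simp; tauto) hxy
  simp only [Set.mem_insert_iff, Set.mem_singleton_iff, exists_eq_or_imp, exists_eq_left] at c1 c2 c3
  apply h
  have rxy : r x y ∨ r x z := by tauto
  have ryz : r y x ∨ r y z := by tauto
  have rzx : r z x ∨ r z y := by tauto
  have h1 : r x y ∧ r x z := by
    rcases rxy with h1 | h1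
    · refine ⟨h1, ?_⟩
      rcases rzx with h2 | h2
      · exact hr.symm h2
      · exact hr.trans h1 (hr.symm h2)
    · refine ⟨?_, h1⟩
      rcases ryz with h2 | h2
      · exact hr.symm h2
      · exact hr.trans h1 (hr.symm h2)
  have hx : ∀ s ∈ ({x, y, z} : Set α), r x s := by
    rintro s (rfl | rfl | rfl)
    · exact hr.refl _
    · exact h1.1
    · exact h1.2
  exact fun s hs s' hs' => hr.trans (hr.symm (hx s hs)) (hx s' hs')

/-- Equivalence of elements of `G` as neighbours of `(1, 0)` under its stabiliser. -/
def StabRel (S : Set G) (s s' : G) : Prop :=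
  ∃ θ : bcay S ≃g bcay S, θ (1, 0) = (1, 0) ∧ θ (s, 1) = (s', 1)

theorem equivalence_stabRel (S : Set G) : Equivalence (StabRel S) where
  refl s := ⟨SimpleGraph.Iso.refl, rfl, rfl⟩
  symm := by
    rintro s s' ⟨θ, h1, h2⟩
    exact ⟨θ.symm, by rw [← h1]; exact (θ.symm_apply_apply _).trans h1.symm,
      by rw [← h2]; exact θ.symm_apply_apply _⟩
  trans := by
    rintro s s' s'' ⟨θ, h1, h2⟩ ⟨η, h3, h4⟩
    refine ⟨θ.trans η, ?_, ?_⟩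
    · show η (θ (1, 0)) = _
      rw [h1, h3]
    · show η (θ (s, 1)) = _
      rw [h2, h4]

/-- The neighbour `(s₀, 1)` of `(1, 0)` is fixed by the stabiliser of `(1, 0)`. -/
def IsFixedNeighbor (S : Set G) (s₀ : G) : Prop :=
  ∀ θ : bcay S ≃g bcay S, θ (1, 0) = (1, 0) → θ (s₀, 1) = (s₀, 1)

theorem isFixedNeighbor_of_stabRel {s₀ : G} (hs₀ : s₀ ∈ S)
    (h : ∀ s ∈ S, StabRel S s₀ s → s = s₀) : IsFixedNeighbor S s₀ := by
  intro θ hθ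
  have h1 : (bcay S).Adj (θ (1, 0)) (θ (s₀, 1)) :=
    θ.map_adj_iff.2 (bcay_adj_zero.2 ⟨s₀, hs₀, by rw [mul_one]⟩)
  rw [hθ] at h1
  obtain ⟨s, hs, h2⟩ := bcay_adj_zero.1 h1
  rw [mul_one] at h2
  rw [h2, h s hs ⟨θ, hθ, h2⟩]

theorem iso_symm_base (ψ : bcay S ≃g bcay T) (h : ψ (1, 0) = (1, 0)) : ψ.symm (1, 0) = (1, 0) :=
  (congrArg ψ.symm h.symm).trans (ψ.symm_apply_apply _)

theorem IsFixedNeighbor.map {s₀ t₀ : G} (h : IsFixedNeighbor S s₀) (ψ : bcay S ≃g bcay T)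
    (h1 : ψ (1, 0) = (1, 0)) (h0 : ψ (s₀, 1) = (t₀, 1)) : IsFixedNeighbor T t₀ := by
  intro θ hθ
  have h2 := h ((ψ.trans θ).trans ψ.symm) (by
    show ψ.symm (θ (ψ (1, 0))) = _
    rw [h1, hθ]
    exact iso_symm_base ψ h1)
  have h3 : ψ.symm (θ (ψ (s₀, 1))) = (s₀, 1) := h2
  have h4 := congrArg ψ h3
  rw [h0] at h4
  exact (ψ.apply_symm_apply _).symm.trans h4

/-- Conjugating translations by `ψ` gives an automorphism fixing `(1, 0)`, hence `(s₀, 1)`. So `ψ`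
respects the matching defined by `s₀` and `t₀`. -/
theorem image_fixedNeighbor {s₀ t₀ : G} (h : IsFixedNeighbor S s₀) (ψ : bcay S ≃g bcay T)
    (h1 : ψ (1, 0) = (1, 0)) (h0 : ψ (s₀, 1) = (t₀, 1)) {x y : G} (hx : ψ (x, 0) = (y, 0)) :
    ψ (s₀ * x, 1) = (t₀ * y, 1) := by
  have h2 := h ((((bcayRight S x).trans ψ).trans (bcayRight T y⁻¹)).trans ψ.symm) (by
    show ψ.symm (bcayRight T y⁻¹ (ψ (bcayRight S x (1, 0)))) = _
    have e : bcayRight S x (1, 0) = (x, 0) := by simp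
    rw [e, hx, bcayRight_apply, mul_inv_cancel]
    exact iso_symm_base ψ h1)
  have h3 : ψ.symm (bcayRight T y⁻¹ (ψ (bcayRight S x (s₀, 1)))) = (s₀, 1) := h2
  have h4 := congrArg ψ h3
  rw [h0] at h4
  have h5 : bcayRight T y⁻¹ (ψ (s₀ * x, 1)) = (t₀, 1) := (ψ.apply_symm_apply _).symm.trans h4
  have h6 : ∀ v, bcayRight T y⁻¹ v = (t₀, 1) → v = (t₀ * y, 1) := by
    rintro ⟨z, i⟩ hz
    rw [bcayRight_apply, Prod.mk.injEq] at hz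
    rw [← hz.1, hz.2, inv_mul_cancel_right]
  exact h6 _ h5

/-- An arc `x → s₀⁻¹ s x` is the edge from `(x, 0)` to `(s x, 1)` followed by the matching edge back
to side `0`; `ψ` preserves both kinds of edge. -/
theorem localIso_of_bcay_iso {s₀ s₁ s₂ t₀ t₁ t₂ : G} (hS : S = {s₀, s₁, s₂})
    (hT : T = {t₀, t₁, t₂}) (hs : s₁ ≠ s₂) (h01 : s₀ ≠ s₁) (h02 : s₀ ≠ s₂)
    (h : IsFixedNeighbor S s₀) (ψ : bcay S ≃g bcay T)
    (h1 : ψ (1, 0) = (1, 0)) (h0 : ψ (s₀, 1) = (t₀, 1)) :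
    LocalIso (fun x => (ψ (x, 0)).1) (s₀⁻¹ * s₁) (s₀⁻¹ * s₂) (t₀⁻¹ * t₁) (t₀⁻¹ * t₂) := by
  have m0 : s₀ ∈ S := by rw [hS]; simp
  have m1 : s₁ ∈ S := by rw [hS]; simp
  have m2 : s₂ ∈ S := by rw [hS]; simp
  have nbr : ∀ {s}, s ∈ S → ∀ x, (bcay T).Adj (ψ (x, 0)) (ψ (s * x, 1)) := fun hs x =>
    ψ.map_adj_iff.2 (bcay_adj_zero.2 ⟨_, hs, rfl⟩)
  have side2 : ∀ {s}, s ∈ S → ∀ x, (ψ (s₀⁻¹ * s * x, 0)).2 = (ψ (x, 0)).2 := fun {s} hs x => by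
    refine snd_eq_of_common_neighbor (S := T) (u := ψ (s * x, 1)) ?_ (nbr hs x)
    have := nbr m0 (s₀⁻¹ * s * x)
    rwa [← mul_assoc, mul_inv_cancel_left] at this
  have side : ∀ x ∈ Subgroup.closure {s₀⁻¹ * s₁, s₀⁻¹ * s₂}, (ψ (x, 0)).2 = 0 := by
    intro x hx
    refine Subgroup.closure_induction_left (p := fun x _ => (ψ (x, 0)).2 = 0) ?_ ?_ ?_ hx
    · rw [h1]
    · rintro g (rfl | rfl) y hy hpy
      · rw [side2 m1, hpy]
      · rw [side2 m2, hpy]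
    · rintro g (rfl | rfl) y hy hpy
      · rw [← side2 m1, mul_inv_cancel_left, hpy]
      · rw [← side2 m2, mul_inv_cancel_left, hpy]
  have val : ∀ x ∈ Subgroup.closure {s₀⁻¹ * s₁, s₀⁻¹ * s₂}, ψ (x, 0) = ((ψ (x, 0)).1, 0) :=
    fun x hx => Prod.ext rfl (side x hx)
  refine ⟨congrArg Prod.fst h1, ?_, ?_⟩
  · intro x hx y hy hxy
    have : ψ (x, 0) = ψ (y, 0) := by rw [val x hx, val y hy]; exact Prod.ext hxy rfl
    exact congrArg Prod.fst (ψ.injective this)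
  · intro x hx
    have step : ∀ s ∈ S, s ≠ s₀ → s₀⁻¹ * s * x ∈ Subgroup.closure {s₀⁻¹ * s₁, s₀⁻¹ * s₂} →
        ∃ t, (t = t₁ ∨ t = t₂) ∧ ψ (s * x, 1) = (t * (ψ (x, 0)).1, 1) ∧
          (ψ (s₀⁻¹ * s * x, 0)).1 = t₀⁻¹ * t * (ψ (x, 0)).1 := by
      intro s hsS hs0 hm
      have a1 := nbr hsS x
      rw [val x hx] at a1
      obtain ⟨t, ht, e⟩ := bcay_adj_zero.1 a1
      have a2 := image_fixedNeighbor h ψ h1 h0 (val _ hm)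
      rw [← mul_assoc, mul_inv_cancel_left, e] at a2
      have a3 : t * (ψ (x, 0)).1 = t₀ * (ψ (s₀⁻¹ * s * x, 0)).1 := congrArg Prod.fst a2
      refine ⟨t, ?_, e, by rw [mul_assoc t₀⁻¹, a3, inv_mul_cancel_left]⟩
      rw [hT] at ht
      rcases ht with rfl | ht
      -- The value `t₀` is excluded: it is already taken by the matching edge at `x`.
      · have a4 := image_fixedNeighbor h ψ h1 h0 (val _ hx)
        rw [← e] at a4
        exact absurd (mul_right_cancel (congrArg Prod.fst (ψ.injective a4))).symm hs0
      · exact ht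
    obtain ⟨t, ht, e, f⟩ := step s₁ m1 h01.symm (left_mul_mem hx)
    obtain ⟨t', ht', e', f'⟩ := step s₂ m2 h02.symm (right_mul_mem hx)
    have hne : t ≠ t' := fun he => by
      rw [he, ← e'] at e
      exact hs (mul_right_cancel (congrArg Prod.fst (ψ.injective e)))
    rcases ht with rfl | rfl <;> rcases ht' with rfl | rfl
    · exact absurd rfl hne
    · exact Or.inl ⟨f, f'⟩
    · exact Or.inr ⟨f, f'⟩
    · exact absurd rfl hne

/-- Every pair of elements is inverted by an automorphism. -/
def PairInvertible (G : Type*) [Group G] : Prop :=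
  ∀ a b : G, ∃ α : G ≃* G, α a = a⁻¹ ∧ α b = b⁻¹

theorem isBCIGraph_of_locallyRigid (hR : LocallyRigid G) (hI : PairInvertible G)
    (hS : S.ncard = 3) (hAT : ¬ IsArcTransitive (bcay S)) : IsBCIGraph S := by
  have swap : ∀ {s₀ s₁ s₂ : G}, S = {s₀, s₁, s₂} → ∃ σ : bcay S ≃g bcay S,
      ∀ x, (∃ y, σ (x, 0) = (y, 1)) ∧ ∃ y, σ (x, 1) = (y, 0) := by
    intro s₀ s₁ s₂ h
    obtain ⟨α, h1, h2⟩ := hI (s₀⁻¹ * s₁) (s₀⁻¹ * s₂)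
    refine exists_bcay_swap (s₀ := s₀) α ?_
    rw [h]
    rintro s (rfl | rfl | rfl)
    · simp
    · exact h1
    · exact h2
  have hnot : ¬ ∀ s ∈ S, ∀ s' ∈ S, StabRel S s s' := by
    intro hall
    obtain ⟨x, y, z, -, -, -, h⟩ := Set.ncard_eq_three.1 hS
    obtain ⟨σ, hσ⟩ := swap h
    exact hAT (isArcTransitive_bcay σ (fun x => (hσ x).2) hall)
  obtain ⟨s₀, s₁, s₂, hS', h12, hiso⟩ := exists_isolated hS (equivalence_stabRel S) hnot
  have h01 : s₀ ≠ s₁ := by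
    rintro rfl
    rw [hS', Set.insert_eq_of_mem (Set.mem_insert _ _)] at hS
    have := Set.ncard_insert_le s₀ {s₂}
    rw [hS, Set.ncard_singleton] at this
    omega
  have h02 : s₀ ≠ s₂ := by
    rintro rfl
    rw [hS', Set.insert_eq_of_mem (by simp)] at hS
    have := Set.ncard_insert_le s₁ {s₀}
    rw [hS, Set.ncard_singleton] at this
    omega
  have m0 : s₀ ∈ S := by rw [hS']; simp
  have m1 : s₁ ∈ S := by rw [hS']; simp
  have m2 : s₂ ∈ S := by rw [hS']; simp
  have hfix := isFixedNeighbor_of_stabRel m0 hiso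
  rintro T ⟨ψ₀⟩
  obtain ⟨ψ, hψ⟩ : ∃ ψ : bcay S ≃g bcay T, ψ (1, 0) = (1, 0) := by
    obtain ⟨σ, hσ⟩ := swap hS'
    have h0 : ∃ ψ : bcay S ≃g bcay T, (ψ (1, 0)).2 = 0 := by
      by_cases h : (ψ₀ (1, 0)).2 = 0
      · exact ⟨ψ₀, h⟩
      · obtain ⟨y, hy⟩ := (hσ 1).1
        -- This automorphism sends `(1, 0)` to its neighbour `(s₀, 1)`, which `ψ₀` places on the
        -- opposite side.
        refine ⟨(σ.trans (bcayRight S (y⁻¹ * s₀))).trans ψ₀, ?_⟩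
        show (ψ₀ (bcayRight S (y⁻¹ * s₀) (σ (1, 0)))).2 = 0
        rw [hy, bcayRight_apply, mul_inv_cancel_left]
        have h1 : (bcay T).Adj (ψ₀ (1, 0)) (ψ₀ (s₀, 1)) :=
          ψ₀.map_adj_iff.2 (bcay_adj_zero.2 ⟨s₀, m0, by rw [mul_one]⟩)
        have h2 := snd_ne_of_bcay_adj h1
        omega
    obtain ⟨ψ, h⟩ := h0
    refine ⟨ψ.trans (bcayRight T (ψ (1, 0)).1⁻¹), ?_⟩
    show bcayRight T (ψ (1, 0)).1⁻¹ (ψ (1, 0)) = _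
    have e : ψ (1, 0) = ((ψ (1, 0)).1, 0) := Prod.ext rfl h
    generalize (ψ (1, 0)).1 = y at e
    rw [e, bcayRight_apply, mul_inv_cancel]
  have img : ∀ s ∈ S, ∃ t ∈ T, ψ (s, 1) = (t, 1) := by
    intro s hs
    have h1 : (bcay T).Adj (ψ (1, 0)) (ψ (s, 1)) :=
      ψ.map_adj_iff.2 (bcay_adj_zero.2 ⟨s, hs, by rw [mul_one]⟩)
    rw [hψ] at h1
    obtain ⟨t, ht, h2⟩ := bcay_adj_zero.1 h1
    exact ⟨t, ht, by rw [h2, mul_one]⟩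
  obtain ⟨t₀, n0, e0⟩ := img s₀ m0
  obtain ⟨t₁, n1, e1⟩ := img s₁ m1
  obtain ⟨t₂, n2, e2⟩ := img s₂ m2
  have hψ' := iso_symm_base ψ hψ
  have hT : T = {t₀, t₁, t₂} := by
    apply Set.Subset.antisymm
    · intro t ht
      have h1 : (bcay S).Adj (ψ.symm (1, 0)) (ψ.symm (t, 1)) :=
        ψ.symm.map_adj_iff.2 (bcay_adj_zero.2 ⟨t, ht, by rw [mul_one]⟩)
      rw [hψ'] at h1
      obtain ⟨s, hs, h2⟩ := bcay_adj_zero.1 h1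
      have h3 : (t, 1) = ψ (s, 1) := by
        rw [mul_one] at h2
        rw [← h2]
        exact (ψ.apply_symm_apply _).symm
      rw [hS'] at hs
      rcases hs with rfl | rfl | rfl
      · exact Or.inl (congrArg Prod.fst (h3.trans e0))
      · exact Or.inr (Or.inl (congrArg Prod.fst (h3.trans e1)))
      · exact Or.inr (Or.inr (congrArg Prod.fst (h3.trans e2)))
    · rintro t (rfl | rfl | rfl) <;> assumption
  have tne : ∀ {s s' t t' : G}, ψ (s, 1) = (t, 1) → ψ (s', 1) = (t', 1) → s ≠ s' → t ≠ t' := by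
    rintro s s' t t' h h' hne rfl
    exact hne (congrArg Prod.fst (ψ.injective (h.trans h'.symm)))
  have l1 := localIso_of_bcay_iso hS' hT h12 h01 h02 hfix ψ hψ e0
  have l2 := localIso_of_bcay_iso hT hS' (tne e1 e2 h12) (tne e0 e1 h01) (tne e0 e2 h02)
    (hfix.map ψ hψ e0) ψ.symm hψ' (by rw [← e0]; exact ψ.symm_apply_apply _)
  obtain ⟨α, hα⟩ := hR _ _ _ _ _ _ (fun h => h12 (mul_left_cancel h))
    (fun h => tne e1 e2 h12 (mul_left_cancel h)) l1 l2
  refine ⟨t₀ * (α s₀)⁻¹, α, ?_⟩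
  have im : ∀ s t, α (s₀⁻¹ * s) = t₀⁻¹ * t → t₀ * (α s₀)⁻¹ * α s = t := fun s t h => by
    rw [mul_assoc, ← map_inv, ← map_mul, h, mul_inv_cancel_left]
  have im0 : t₀ * (α s₀)⁻¹ * α s₀ = t₀ := inv_mul_cancel_right _ _
  rw [hS', hT, Set.image_insert_eq, Set.image_pair, im0]
  rcases hα with ⟨h1, h2⟩ | ⟨h1, h2⟩
  · rw [im _ _ h1, im _ _ h2]
  · rw [im _ _ h1, im _ _ h2, Set.pair_comm]

end graph

/-! ### Groups of the class -/

section classC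

theorem PairInvertible.prod {U V : Type*} [Group U] [Group V] (hU : PairInvertible U)
    (hV : PairInvertible V) : PairInvertible (U × V) := by
  intro a b
  obtain ⟨α, h1, h2⟩ := hU a.1 b.1
  obtain ⟨β, h3, h4⟩ := hV a.2 b.2
  exact ⟨α.prodCongr β, Prod.ext h1 h3, Prod.ext h2 h4⟩

theorem pairInvertible_of_comm (G : Type*) [CommGroup G] : PairInvertible G :=
  fun _ _ => ⟨MulEquiv.inv G, rfl, rfl⟩

theorem PairInvertible.congr {G G' : Type*} [Group G] [Group G'] (e : G ≃* G')
    (h : PairInvertible G) : PairInvertible G' := by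
  intro a b
  obtain ⟨α, h1, h2⟩ := h (e.symm a) (e.symm b)
  exact ⟨(e.symm.trans α).trans e, by simp [h1], by simp [h2]⟩

theorem pairInvertible_quaternion : PairInvertible (QuaternionGroup 2) := by
  intro a b
  obtain ⟨g, h1, h2⟩ := quaternion_exists_mulEquiv_inv a b
  exact ⟨MulAut.conj g, by simpa using h1, by simpa using h2⟩

theorem card_pi_zmod (n k : ℕ) : Nat.card (Fin k → Multiplicative (ZMod n)) = n ^ k := by
  rw [Nat.card_fun, Nat.card_congr Multiplicative.toAdd, Nat.card_zmod, Nat.card_eq_fintype_card,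
    Fintype.card_fin]

/-- A homocyclic group of odd order is a power of `ZMod n` with `n` odd. -/
theorem exists_odd_of_isHomocyclic {U : Type*} [Group U] (hU : IsHomocyclic U)
    (hodd : Odd (Nat.card U)) :
    ∃ n k : ℕ, Odd n ∧ Nonempty (U ≃* (Fin k → Multiplicative (ZMod n))) := by
  obtain ⟨-, n, k, ⟨e⟩⟩ := hU
  -- For `k = 0` the given `n` is arbitrary, possibly even or zero, and is replaced by `1`.
  rcases Nat.eq_zero_or_pos k with rfl | hk
  · refine ⟨1, 0, odd_one, ⟨e.trans ?_⟩⟩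
    exact { toEquiv := Equiv.ofUnique _ _, map_mul' := fun _ _ => Subsingleton.elim _ _ }
  · rw [Nat.card_congr e.toEquiv, card_pi_zmod] at hodd
    exact ⟨n, k, (Nat.odd_pow_iff hk.ne').1 hodd, ⟨e⟩⟩

theorem locallyRigid_and_pairInvertible {G : Type*} [Group G] (hG : IsInClassC G) :
    LocallyRigid G ∧ PairInvertible G := by
  obtain ⟨U, V, _, _, ⟨hU, hodd⟩, hV, ⟨e⟩⟩ := hG
  obtain ⟨n, k, hn, ⟨f⟩⟩ := exists_odd_of_isHomocyclic hU hodd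
  rw [Nat.card_congr f.toEquiv] at hodd
  have : NeZero n := ⟨hn.pos.ne'⟩
  have hhU := pairHomogeneous_pi_zmod n k
  have hcop : ∀ {W : Type} {r : ℕ}, Nat.card W = 2 ^ r →
      (Nat.card (Fin k → Multiplicative (ZMod n))).Coprime (Nat.card W) := fun h => by
    rw [h]
    exact Nat.Coprime.pow_right _ (Nat.coprime_two_right.2 hodd)
  suffices hmain : ∃ (W : Type) (_ : Group W), Nonempty (V ≃* W) ∧
      LocallyRigid ((Fin k → Multiplicative (ZMod n)) × W) ∧ PairInvertible W by
    obtain ⟨W, _, ⟨g⟩, h1, h2⟩ := hmain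
    have e' := (e.trans (f.prodCongr g)).symm
    exact ⟨h1.congr e', ((pairInvertible_of_comm _).prod h2).congr e'⟩
  have helem : ∀ r : ℕ, LocallyRigid
      ((Fin k → Multiplicative (ZMod n)) × (Fin r → Multiplicative (ZMod 2))) := by
    intro r
    have hV2 : ∀ v : Fin r → Multiplicative (ZMod 2), v ^ 2 = 1 := fun v => by
      funext i
      have : ∀ z : Multiplicative (ZMod 2), z ^ 2 = 1 := by decide
      exact this (v i)
    have hhV := pairHomogeneous_pi_zmod 2 r
    exact locallyRigid_of_exponent_two hodd hV2 hhU hhV (hhU.prod hhV (hcop (card_pi_zmod 2 r)))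
  rcases hV with hV | ⟨r, ⟨g⟩⟩ | ⟨r, ⟨g⟩⟩ | ⟨⟨g⟩⟩
  · refine ⟨Fin 0 → Multiplicative (ZMod 2), inferInstance, ⟨?_⟩, helem 0,
      pairInvertible_of_comm _⟩
    exact { toFun := fun _ => 1, invFun := fun _ => 1, left_inv := fun _ => Subsingleton.elim _ _,
            right_inv := fun _ => Subsingleton.elim _ _,
            map_mul' := fun _ _ => Subsingleton.elim _ _ }
  · have : NeZero (2 ^ r) := ⟨by positivity⟩
    have hhV : PairHomogeneous (Multiplicative (ZMod (2 ^ r))) :=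
      (pairHomogeneous_pi_zmod (2 ^ r) 1).congr (MulEquiv.piUnique _)
    refine ⟨_, _, ⟨g⟩, ?_, pairInvertible_of_comm _⟩
    have : Finite (Multiplicative (ZMod (2 ^ r))) := Finite.of_equiv _ Multiplicative.ofAdd
    exact locallyRigid_of_atMostOneInvolution
      (hhU.prod hhV (hcop (r := r) (by rw [Nat.card_congr Multiplicative.toAdd, Nat.card_zmod])))
      (atMostOneInvolution_prod hodd atMostOneInvolution_of_isCyclic)
  · exact ⟨_, _, ⟨g⟩, helem r, pairInvertible_of_comm _⟩
  · exact ⟨_, _, ⟨g⟩, locallyRigid_prod_quaternion hodd hhU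
      (hhU.prod pairHomogeneous_quaternion (hcop quaternion_card)), pairInvertible_quaternion⟩

end classC

theorem theorem2 {G : Type*} [Group G] [Finite G] (hG : IsInClassC G)
    (S : Set G) (hS : S.ncard = 3) (hAT : ¬ IsArcTransitive (bcay S)) :
    IsBCIGraph S :=
  have h := locallyRigid_and_pairInvertible hG
  isBCIGraph_of_locallyRigid h.1 h.2 hS hAT
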